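/- Let $b\ge 2$ and let $\eta_{ij}$, $i,j\in\{1,\dots,b\}$, be real random variables on a common probability space. Put $\mathbb D=\{s\in\mathbb R:\ \mathbb E e^{-s\eta_{ij}}<\infty\ \ \forall i,j\}$ and assume $[0,1]\subseteq\mathbb D$, $0\in\operatorname{Int}\mathbb D$, $\mathbb E|\eta_{ij}|<\infty$ and $\mathbb E|\eta_{ij}e^{-\eta_{ij}}|<\infty$ for all $i,j$. Consider the multi-type branching random walk on $\mathbb R$ that starts with one particle, of an arbitrary type $i_0\in\{1,\dots,b\}$, at $0$, and in which at every time step each particle is replaced by $b$ children, one of each type $1,\dots,b$. The vector of jumps from a particle of type $i$ to its children of types $1,\dots,b$ is distributed as $(\eta_{i1},\dots,\eta_{ib})$, and the jump vectors of different particles are independent (the case of independent $\eta_{i1},\dots,\eta_{ib}$, where all jumps are independent, is included). Let $\mu_t$ be the minimum of the positions of the $b^t$ particles of generation $t$. For $s\ge 0$ let $\rho(s)$ be the largest eigenvalue of the matrix $(\mathbb E e^{-s\eta_{ij}})_{i,j=1}^b$, with $\rho(s)=+\infty$ if $s\notin\mathbb D$, and for $x\in\mathbb R$ let $\lambda^{(x)}=\inf_{s\ge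 0}e^{sx}\rho(s)$. 1. If $x_0\in\mathbb R$ satisfies $\lambda^{(x_0)}=1$, then $x_0$ is the only solution of this equation, and $\lim_{t\to\infty}\mu_t/t=x_0$ almost surely. 2. A solution $x_0$ exists if $0<\lambda^{(x)}\le 1$ for some $x\in\mathbb R$ (that is, unless $\lambda^{(x)}$ jumps from $0$ to a value larger than $1$). 3. In every case there is an $x_0\in\mathbb R$ with $\lambda^{(x)}<1$ for all $x<x_0$ and $\lambda^{(x)}>1$ for all $x>x_0$, and $\lim_{t\to\infty}\mu_t/t=x_0$ almost surely. -/

import Mathlib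

open MeasureTheory ProbabilityTheory Filter Topology
open scoped ENNReal

namespace ColouredBRW

/-- The largest (real) eigenvalue of a real square matrix. -/
noncomputable def largestEigenvalue {b : ℕ} (A : Matrix (Fin b) (Fin b) ℝ) : ℝ :=
  sSup {r : ℝ | Module.End.HasEigenvalue (Matrix.toLin' A) r}

section Displacement

variable {b : ℕ} {Ω₀ : Type*} [MeasurableSpace Ω₀]

/-- The set `𝔻` of all real `s` with `𝔼 exp (-s η_{ij}) < ∞` for all `i, j`. -/
def expDomain (η : Fin b → Fin b → Ω₀ → ℝ) (P₀ : Measure Ω₀) : Set ℝ :=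
  {s : ℝ | ∀ i j, Integrable (fun ω => Real.exp (-(s * η i j ω))) P₀}

/-- The regularity conditions on the displacements, written for `ξ_{ij} = exp (-η_{ij})`:
`[0,1] ⊆ 𝔻`, `0 ∈ Int 𝔻`, `𝔼 |log ξ_{ij}| < ∞` and `𝔼 |ξ_{ij} log ξ_{ij}| < ∞`. -/
structure Regular (η : Fin b → Fin b → Ω₀ → ℝ) (P₀ : Measure Ω₀) : Prop where
  unitInterval_subset : Set.Icc (0 : ℝ) 1 ⊆ expDomain η P₀
  zero_mem_interior : (0 : ℝ) ∈ interior (expDomain η P₀)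
  integrable_log : ∀ i j, Integrable (fun ω => η i j ω) P₀
  integrable_mul_log : ∀ i j, Integrable (fun ω => Real.exp (-(η i j ω)) * η i j ω) P₀

/-- The matrix `m(s) = (𝔼 exp (-s η_{ij}))_{ij}`, meaningful for `s ∈ 𝔻`. -/
noncomputable def momentMatrix (η : Fin b → Fin b → Ω₀ → ℝ) (P₀ : Measure Ω₀) (s : ℝ) :
    Matrix (Fin b) (Fin b) ℝ :=
  Matrix.of fun i j => ∫ ω, Real.exp (-(s * η i j ω)) ∂P₀

open Classical in
/-- The largest eigenvalue `ρ(s)` of `m(s)`, with `ρ(s) = ∞` as soon as an entry of `m(s)` is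
infinite. -/
noncomputable def rho (η : Fin b → Fin b → Ω₀ → ℝ) (P₀ : Measure Ω₀) (s : ℝ) : ℝ≥0∞ :=
  if s ∈ expDomain η P₀ then ENNReal.ofReal (largestEigenvalue (momentMatrix η P₀ s)) else ⊤

/-- `λ^{(x)} = inf_{s ≥ 0} exp (s x) ρ(s)`. -/
noncomputable def lam (η : Fin b → Fin b → Ω₀ → ℝ) (P₀ : Measure Ω₀) (x : ℝ) : ℝ≥0∞ :=
  ⨅ (s : ℝ) (_ : 0 ≤ s), ENNReal.ofReal (Real.exp (s * x)) * rho η P₀ s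

end Displacement

section Walk

variable {b : ℕ} {Ω : Type*}

/-- The type (colour) of a particle. Particles are words in the colours: `[]` is the initial
particle, which has type `i₀`, and `j :: v` is the child of type `j` of the particle `v`. -/
def colour (i₀ : Fin b) : List (Fin b) → Fin b
  | [] => i₀
  | j :: _ => j

/-- `J v ω j` is the jump from the particle `v` to its child of type `j`; the position of a
particle is the sum of the jumps along its line of descent, starting from `0`. -/
def position (J : List (Fin b) → Ω → Fin b → ℝ) : List (Fin b) → Ω → ℝ
  | [], _ => 0
  | j :: v, ω => position J v ω + J v ω j

/-- The minimal displacement `μ_t`: the minimum of the positions of the `b ^ t` particles of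
generation `t` (a finite family, nonempty for `b ≥ 1`, so that the infimum is a minimum). -/
noncomputable def minDisplacement (J : List (Fin b) → Ω → Fin b → ℝ) (t : ℕ) (ω : Ω) : ℝ :=
  ⨅ v : List.Vector (Fin b) t, position J v.toList ω

/-- `J` is the family of jumps of a multi-type branching random walk with displacements `η`,
started from one particle of type `i₀`: the jumps from a particle of type `i` to its `b` children
are distributed as `(η_{i1}, …, η_{ib})`, and the vectors of jumps of different particles are
independent. Jumps to siblings may depend on each other in any way; if the variables
`η_{i1}, …, η_{ib}` are independent, then all the jumps are. -/
structure IsWalk {Ω₀ : Type*} [MeasurableSpace Ω₀] [MeasurableSpace Ω]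
    (η : Fin b → Fin b → Ω₀ → ℝ) (P₀ : Measure Ω₀) (i₀ : Fin b)
    (J : List (Fin b) → Ω → Fin b → ℝ) (P : Measure Ω) : Prop where
  identDistrib : ∀ v, IdentDistrib (J v) (fun ω₀ j => η (colour i₀ v) j ω₀) P P₀
  indep : iIndepFun J P

end Walk

end ColouredBRW

/-! The function `lam` is an infimum over `s` of functions log-affine in `x`, so it is nondecreasing
and log-concave. It is below `1` far to the left (take `s = 1`) and at least `b > 1` far to the
right (Jensen), so it crosses the level `1` at exactly one point `x₀` (`exists_lam_crossing`).
Continuity in `x` for fixed `s` gives `1 ≤ lam x₀`, and log-concavity gives the opposite inequality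
unless `lam` jumps at `x₀` from `0` (`lam_crossing_eq_one`).

Lower bound for the speed: by the many-to-one formula, the mean numbers of particles of the various
types have the powers of the moment matrix as Laplace transforms. Chernoff's bound with Perron's
theorem then gives `P (μ_t ≤ t x) ≤ b C (exp (s x) ρ(s)) ^ t`. If `lam x < 1`, some `s` makes this
summable, and Borel–Cantelli applies.

Upper bound: if `1 < lam x'` and `x' < x`, then for some `k` the mean number of generation-`k`
particles of the initial type at most at `k * x` exceeds `1` (`exists_one_lt_meanMeasure`). This is
a Cramér-type lower bound, obtained by convex duality without tilting: otherwise a supporting line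
for the growth rate would bound the Laplace transforms and force `lam x' ≤ 1`. Jumping `k`
generations at a time now gives an embedded process that survives with positive probability.
Arbitrarily many independent trials make it survive almost surely from some particle in every
residue class modulo `k`, which controls `μ_t` for all large `t`. -/

namespace ColouredBRW

/-! ### Perron theory of positive matrices. -/

section Perron

variable {b : ℕ}

lemma mulVec_pos_of_nonneg_of_ne_zero {A : Matrix (Fin b) (Fin b) ℝ} (hA : ∀ i j, 0 < A i j)
    {z : Fin b → ℝ} (hz : ∀ i, 0 ≤ z i) {k : Fin b} (hk : z k ≠ 0) (i : Fin b) :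
    0 < A.mulVec z i :=
  Finset.sum_pos' (fun j _ => mul_nonneg (hA i j).le (hz j))
    ⟨k, Finset.mem_univ k, mul_pos (hA i k) (lt_of_le_of_ne (hz k) hk.symm)⟩

/-- The existence part of Perron's theorem, by maximising the Collatz–Wielandt quotient. -/
theorem exists_pos_eigenvector (hb : 0 < b) {A : Matrix (Fin b) (Fin b) ℝ}
    (hA : ∀ i j, 0 < A i j) :
    ∃ r : ℝ, 0 < r ∧ ∃ v : Fin b → ℝ, (∀ i, 0 < v i) ∧ A.mulVec v = r • v := by
  have : Nonempty (Fin b) := ⟨⟨0, hb⟩⟩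
  set R : ℝ := ∑ i, ∑ j, A i j with hR
  have hbound : ∀ x ∈ stdSimplex ℝ (Fin b), ∀ r : ℝ, (∀ i, r * x i ≤ A.mulVec x i) → r ≤ R := by
    intro x hx r hr
    calc r = ∑ i, r * x i := by rw [← Finset.mul_sum, hx.2, mul_one]
      _ ≤ ∑ i, A.mulVec x i := Finset.sum_le_sum fun i _ => hr i
      _ ≤ R := by
        simp only [hR, Matrix.mulVec, dotProduct]
        refine Finset.sum_le_sum fun i _ => Finset.sum_le_sum fun j _ => ?_
        have : x j ≤ 1 := by
          rw [← hx.2]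
          exact Finset.single_le_sum (f := x) (fun i _ => hx.1 i) (Finset.mem_univ j)
        exact mul_le_of_le_one_right (hA i j).le this
  set S : Set ((Fin b → ℝ) × ℝ) :=
    (stdSimplex ℝ (Fin b) ×ˢ Set.Icc 0 R) ∩ {p | ∀ i, p.2 * p.1 i ≤ A.mulVec p.1 i} with hS
  have hcont : ∀ i, Continuous fun p : (Fin b → ℝ) × ℝ => A.mulVec p.1 i := by
    intro i
    simp only [Matrix.mulVec, dotProduct]
    fun_prop
  have hScompact : IsCompact S := by
    refine ((isCompact_stdSimplex ℝ (Fin b)).prod isCompact_Icc).inter_right ?_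
    rw [Set.ofPred_forall]
    exact isClosed_iInter fun i => isClosed_le (by fun_prop) (hcont i)
  have hSne : S.Nonempty := by
    obtain ⟨x, hx⟩ : (stdSimplex ℝ (Fin b)).Nonempty :=
      ⟨Pi.single ⟨0, hb⟩ 1, single_mem_stdSimplex ℝ _⟩
    have h0 : ∀ i, (0 : ℝ) * x i ≤ A.mulVec x i := fun i => by
      simp only [zero_mul, Matrix.mulVec, dotProduct]
      exact Finset.sum_nonneg fun j _ => mul_nonneg (hA i j).le (hx.1 j)
    exact ⟨(x, 0), ⟨hx, le_refl _, hbound x hx 0 h0⟩, h0⟩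
  obtain ⟨⟨x, r⟩, ⟨⟨hx, hr0, -⟩, hxr⟩, hmax⟩ :=
    hScompact.exists_isMaxOn hSne continuous_snd.continuousOn
  simp only at hx hr0 hxr
  obtain ⟨k, hk⟩ : ∃ k, x k ≠ 0 := by
    by_contra! h
    have := hx.2
    simp [h] at this
  have hy : ∀ i, 0 < A.mulVec x i := mulVec_pos_of_nonneg_of_ne_zero hA hx.1 hk
  have heq : A.mulVec x = r • x := by
    by_contra hne
    obtain ⟨l, hl⟩ : ∃ l, A.mulVec x l ≠ r * x l := by
      by_contra! h
      exact hne (funext h)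
    -- The vector `y - r • x` is nonnegative and nonzero, so `A` makes it positive everywhere. Hence
    -- `y`, normalised, satisfies the defining inequality with `r + ε`, against the maximality of
    -- `r`.
    set y := A.mulVec x with hydef
    have hz : ∀ i, 0 < A.mulVec (y - r • x) i :=
      mulVec_pos_of_nonneg_of_ne_zero hA (fun i => by simpa using hxr i)
        (k := l) (by simpa [sub_eq_zero] using hl)
    obtain ⟨m, -, hm⟩ := Finset.exists_min_image Finset.univ
      (fun i => A.mulVec (y - r • x) i / y i) Finset.univ_nonempty
    set ε := A.mulVec (y - r • x) m / y m with hε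
    have hεpos : 0 < ε := div_pos (hz m) (hy m)
    have hyr : ∀ i, (r + ε) * y i ≤ A.mulVec y i := by
      intro i
      have h1 : ε * y i ≤ A.mulVec (y - r • x) i :=
        (le_div_iff₀ (hy i)).1 (hm i (Finset.mem_univ i))
      rw [Matrix.mulVec_sub, Matrix.mulVec_smul, ← hydef] at h1
      simp only [Pi.sub_apply, Pi.smul_apply, smul_eq_mul] at h1
      linarith
    set c := ∑ i, y i with hc
    have hcpos : 0 < c := Finset.sum_pos (fun i _ => hy i) Finset.univ_nonempty
    have hsimp : c⁻¹ • y ∈ stdSimplex ℝ (Fin b) := by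
      refine ⟨fun i => mul_nonneg (inv_nonneg.2 hcpos.le) (hy i).le, ?_⟩
      simp only [Pi.smul_apply, smul_eq_mul, ← Finset.mul_sum]
      exact inv_mul_cancel₀ hcpos.ne'
    have hcyr : ∀ i, (r + ε) * (c⁻¹ • y) i ≤ A.mulVec (c⁻¹ • y) i := by
      intro i
      rw [Matrix.mulVec_smul]
      simp only [Pi.smul_apply, smul_eq_mul]
      calc (r + ε) * (c⁻¹ * y i) = c⁻¹ * ((r + ε) * y i) := by ring
        _ ≤ _ := mul_le_mul_of_nonneg_left (hyr i) (inv_nonneg.2 hcpos.le)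
    have := hmax (a := (c⁻¹ • y, r + ε))
      ⟨⟨hsimp, by positivity, hbound _ hsimp _ hcyr⟩, hcyr⟩
    simp only [Set.mem_ofPred_eq] at this
    linarith
  have hxpos : ∀ i, 0 < r * x i := fun i => by
    have := hy i
    rwa [heq] at this
  have hrpos : 0 < r := lt_of_le_of_ne hr0 fun h => by
    have := hxpos k
    simp [← h] at this
  exact ⟨r, hrpos, x, fun i => pos_of_mul_pos_right (hxpos i) hrpos.le, heq⟩

/-- The eigenvalue of a positive eigenvector dominates all real eigenvalues. -/
theorem largestEigenvalue_eq (hb : 0 < b) {A : Matrix (Fin b) (Fin b) ℝ} (hA : ∀ i j, 0 < A i j)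
    {r : ℝ} {v : Fin b → ℝ} (hv : ∀ i, 0 < v i) (hAv : A.mulVec v = r • v) :
    largestEigenvalue A = r := by
  have : Nonempty (Fin b) := ⟨⟨0, hb⟩⟩
  refine IsGreatest.csSup_eq ⟨?_, ?_⟩
  · refine Module.End.hasEigenvalue_of_hasEigenvector (x := v)
      (Module.End.hasEigenvector_iff.2 ⟨Module.End.mem_eigenspace_iff.2 ?_, ?_⟩)
    · rw [Matrix.toLin'_apply, hAv]
    · intro h
      have := hv ⟨0, hb⟩
      simp [h] at this
  · intro q hq
    obtain ⟨w, hw⟩ := Module.End.HasEigenvalue.exists_hasEigenvector hq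
    have hAw : A.mulVec w = q • w := by
      rw [← Matrix.toLin'_apply]
      exact hw.apply_eq_smul
    -- At the index maximising `|w i| / v i`, the equation for `w` can be compared with the one for
    -- `v`.
    obtain ⟨m, -, hm⟩ := Finset.exists_max_image Finset.univ
      (fun i => |w i| / v i) Finset.univ_nonempty
    have hle : ∀ i, |w i| ≤ |w m| / v m * v i := fun i =>
      (div_le_iff₀ (hv i)).1 (hm i (Finset.mem_univ i))
    have hwm : 0 < |w m| := by
      rw [abs_pos]
      intro h0
      refine hw.2 (funext fun i => ?_)
      have := hle i
      rw [h0, abs_zero, zero_div, zero_mul] at this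
      exact abs_nonpos_iff.1 this
    have h1 : q * |w m| ≤ r * |w m| :=
      calc q * |w m| ≤ |q * w m| := by
            rw [abs_mul]
            exact mul_le_mul_of_nonneg_right (le_abs_self q) (abs_nonneg _)
        _ = |A.mulVec w m| := by rw [hAw]; rfl
        _ ≤ ∑ j, |A m j * w j| := by
            simp only [Matrix.mulVec, dotProduct]
            exact Finset.abs_sum_le_sum_abs _ _
        _ ≤ ∑ j, A m j * (|w m| / v m * v j) := by
            refine Finset.sum_le_sum fun j _ => ?_
            rw [abs_mul, abs_of_pos (hA m j)]
            exact mul_le_mul_of_nonneg_left (hle j) (hA m j).le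
        _ = |w m| / v m * A.mulVec v m := by
            simp only [Matrix.mulVec, dotProduct, Finset.mul_sum]
            exact Finset.sum_congr rfl fun j _ => by ring
        _ = r * |w m| := by
            rw [hAv]
            simp only [Pi.smul_apply, smul_eq_mul]
            field_simp [(hv m).ne']
    exact le_of_mul_le_mul_right h1 hwm

lemma pow_mulVec_eq {A : Matrix (Fin b) (Fin b) ℝ} {r : ℝ} {v : Fin b → ℝ}
    (hAv : A.mulVec v = r • v) (k : ℕ) : (A ^ k).mulVec v = r ^ k • v := by
  induction k with
  | zero => simp
  | succ k ih =>
    rw [pow_succ, ← Matrix.mulVec_mulVec, hAv, Matrix.mulVec_smul, ih, smul_smul, pow_succ,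
      mul_comm]

lemma pow_apply_nonneg {A : Matrix (Fin b) (Fin b) ℝ} (hA : ∀ i j, 0 < A i j) (k : ℕ)
    (i j : Fin b) : 0 ≤ (A ^ k) i j := by
  induction k generalizing j with
  | zero => rw [pow_zero, Matrix.one_apply]; split_ifs <;> norm_num
  | succ k ih =>
    rw [pow_succ, Matrix.mul_apply]
    exact Finset.sum_nonneg fun l _ => mul_nonneg (ih l) (hA l j).le

/-- Upper and lower bounds for the entries of the powers of a positive matrix. -/
theorem pow_apply_bounds (hb : 0 < b) {A : Matrix (Fin b) (Fin b) ℝ} (hA : ∀ i j, 0 < A i j) :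
    0 < largestEigenvalue A ∧
    (∃ C : ℝ, 0 < C ∧ ∀ k i j, (A ^ k) i j ≤ C * largestEigenvalue A ^ k) ∧
    (∃ c : ℝ, 0 < c ∧ ∀ k i, c * largestEigenvalue A ^ k ≤ (A ^ (k + 1)) i i) := by
  have : Nonempty (Fin b) := ⟨⟨0, hb⟩⟩
  obtain ⟨r, hr, v, hv, hAv⟩ := exists_pos_eigenvector hb hA
  rw [largestEigenvalue_eq hb hA hv hAv]
  obtain ⟨M, -, hM⟩ := Finset.exists_max_image Finset.univ v Finset.univ_nonempty
  obtain ⟨m, -, hm⟩ := Finset.exists_min_image Finset.univ v Finset.univ_nonempty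
  refine ⟨hr, ⟨v M / v m, div_pos (hv M) (hv m), fun k i j => ?_⟩, ?_⟩
  · have h1 : (A ^ k) i j * v j ≤ r ^ k * v i := by
      have := congrFun (pow_mulVec_eq hAv k) i
      simp only [Pi.smul_apply, smul_eq_mul] at this
      rw [← this]
      exact Finset.single_le_sum (f := fun l => (A ^ k) i l * v l)
        (fun l _ => mul_nonneg (pow_apply_nonneg hA k i l) (hv l).le) (Finset.mem_univ j)
    have h2 : (A ^ k) i j * v m ≤ r ^ k * v M :=
      calc (A ^ k) i j * v m ≤ (A ^ k) i j * v j :=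
            mul_le_mul_of_nonneg_left (hm j (Finset.mem_univ j)) (pow_apply_nonneg hA k i j)
        _ ≤ r ^ k * v i := h1
        _ ≤ r ^ k * v M :=
            mul_le_mul_of_nonneg_left (hM i (Finset.mem_univ i)) (pow_nonneg hr.le k)
    rw [div_mul_eq_mul_div, le_div_iff₀ (hv m)]
    linarith
  -- Every column of `A` dominates a fixed multiple of `v`. Replacing the last factor of `A ^ (k +
  -- 1)` by that multiple leaves `A ^ k` acting on `v`, which explains the shift in the exponent.
  · obtain ⟨p, -, hp⟩ := Finset.exists_min_image (Finset.univ : Finset (Fin b × Fin b))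
      (fun p => A p.1 p.2 / v p.1) Finset.univ_nonempty
    have hc : 0 < A p.1 p.2 / v p.1 := div_pos (hA _ _) (hv _)
    refine ⟨A p.1 p.2 / v p.1 * v m, mul_pos hc (hv m), fun k i => ?_⟩
    have h1 := congrFun (pow_mulVec_eq hAv k) i
    simp only [Pi.smul_apply, smul_eq_mul, Matrix.mulVec, dotProduct] at h1
    calc A p.1 p.2 / v p.1 * v m * r ^ k ≤ A p.1 p.2 / v p.1 * (r ^ k * v i) := by
          rw [mul_assoc, mul_comm (v m)]
          gcongr
          exact hm i (Finset.mem_univ i)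
      _ = ∑ l, (A ^ k) i l * (A p.1 p.2 / v p.1 * v l) := by
          rw [← h1, Finset.mul_sum]
          exact Finset.sum_congr rfl fun l _ => by ring
      _ ≤ ∑ l, (A ^ k) i l * A l i := by
          refine Finset.sum_le_sum fun l _ => mul_le_mul_of_nonneg_left ?_ (pow_apply_nonneg hA k i l)
          exact (le_div_iff₀ (hv l)).1 (hp (l, i) (Finset.mem_univ _))
      _ = _ := by rw [pow_succ, Matrix.mul_apply]

/-- The largest eigenvalue is bounded below by the minimal row sum. -/
theorem le_largestEigenvalue (hb : 0 < b) {A : Matrix (Fin b) (Fin b) ℝ}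
    (hA : ∀ i j, 0 < A i j) {a : ℝ} (ha : ∀ i j, a ≤ A i j) : b * a ≤ largestEigenvalue A := by
  have : Nonempty (Fin b) := ⟨⟨0, hb⟩⟩
  obtain ⟨r, hr, v, hv, hAv⟩ := exists_pos_eigenvector hb hA
  rw [largestEigenvalue_eq hb hA hv hAv]
  obtain ⟨m, -, hm⟩ := Finset.exists_min_image Finset.univ v Finset.univ_nonempty
  have h1 : b * a * v m ≤ r * v m :=
    calc b * a * v m = ∑ _j : Fin b, a * v m := by simp [mul_assoc]
      _ ≤ ∑ j, A m j * v j := Finset.sum_le_sum fun j _ =>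
          mul_le_mul (ha m j) (hm j (Finset.mem_univ j)) (hv m).le (hA m j).le
      _ = r * v m := congrFun hAv m
  exact le_of_mul_le_mul_right h1 (hv m)

end Perron

/-! ### Supporting lines and Laplace transforms. -/

section Superadditive

lemma pow_le_of_superadditive {F : ℕ → ℝ → ℝ} (hF0 : ∀ k z, 0 ≤ F k z)
    (hone : 1 ≤ F 0 0) (hsup : ∀ k l z w, F k z * F l w ≤ F (k + l) (z + w)) (k : ℕ) (z : ℝ)
    (p : ℕ) : F k z ^ p ≤ F (p * k) (p * z) := by
  induction p with
  | zero => simpa using hone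
  | succ p ih =>
    calc F k z ^ (p + 1) = F k z ^ p * F k z := pow_succ _ _
      _ ≤ F (p * k) (p * z) * F k z := mul_le_mul_of_nonneg_right ih (hF0 _ _)
      _ ≤ F (p * k + k) (p * z + z) := hsup _ _ _ _
      _ = F ((p + 1) * k) ((p + 1 : ℕ) * z) := by push_cast; ring_nf

/-- A supporting line for the exponential rate of a supermultiplicative family of distribution
functions whose rate is nonpositive at `x`. -/
theorem exists_exp_bound_of_superadditive {F : ℕ → ℝ → ℝ} {B x x' : ℝ}
    (hF0 : ∀ k z, 0 ≤ F k z) (hone : 1 ≤ F 0 0)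
    (hsup : ∀ k l z w, F k z * F l w ≤ F (k + l) (z + w))
    (hmono : ∀ k, Monotone (F k)) (hB : 1 ≤ B) (hFB : ∀ k z, F k z ≤ B ^ k) (hx : x' < x)
    (hle : ∀ k : ℕ, F k (k * x) ≤ 1) (hex : ∃ k z, 1 < F k z) :
    ∃ s : ℝ, 0 < s ∧ ∀ (k : ℕ) (z : ℝ), F k z ≤ Real.exp (s * (z - k * x')) := by
  have hxx : 0 < x - x' := sub_pos.2 hx
  have hlt : ∀ (k : ℕ) z, 1 < F k z → 1 ≤ k ∧ k * x < z := by
    intro k z h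
    refine ⟨?_, ?_⟩
    · by_contra hk
      have : k = 0 := by omega
      subst this
      have := hFB 0 z
      rw [pow_zero] at this
      linarith
    · by_contra! hz
      have := hmono k hz
      have := hle k
      linarith
  have hpos : ∀ (k : ℕ) z, 1 < F k z → k * (x - x') < z - k * x' ∧ 0 < z - k * x' := by
    intro k z h
    obtain ⟨h1, h2⟩ := hlt k z h
    have h3 : (k : ℝ) * (x - x') < z - k * x' := by linarith
    exact ⟨h3, lt_of_le_of_lt (by positivity) h3⟩
  -- The supremum of `T` is the least slope that works wherever `F > 1`. At such points `z - k * x'`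
  -- exceeds `k * (x - x')`, so the gap between `x'` and `x` keeps the slopes bounded.
  set T : Set ℝ := {q | ∃ (k : ℕ) (z : ℝ), 1 < F k z ∧ q = Real.log (F k z) / (z - k * x')} with hT
  have hbdd : BddAbove T := by
    refine ⟨Real.log B / (x - x'), ?_⟩
    rintro q ⟨k, z, h, rfl⟩
    obtain ⟨h1, h2⟩ := hpos k z h
    have hlog : Real.log (F k z) ≤ k * Real.log B := by
      rw [← Real.log_pow]
      exact Real.log_le_log (by linarith) (hFB k z)
    have hlB : 0 ≤ Real.log B := Real.log_nonneg hB
    rw [div_le_div_iff₀ h2 hxx]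
    calc Real.log (F k z) * (x - x') ≤ k * Real.log B * (x - x') := by gcongr
      _ = Real.log B * (k * (x - x')) := by ring
      _ ≤ _ := by gcongr
  obtain ⟨k₀, z₀, h₀⟩ := hex
  have hTne : T.Nonempty := ⟨_, k₀, z₀, h₀, rfl⟩
  have hs : 0 < sSup T :=
    lt_of_lt_of_le (div_pos (Real.log_pos h₀) (hpos k₀ z₀ h₀).2)
      (le_csSup hbdd ⟨k₀, z₀, h₀, rfl⟩)
  set s := sSup T with hsdef
  refine ⟨s, hs, fun k z => ?_⟩
  rcases lt_or_ge 1 (F k z) with h1 | h1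
  · have h2 := (hpos k z h1).2
    have h3 : Real.log (F k z) / (z - k * x') ≤ s := le_csSup hbdd ⟨k, z, h1, rfl⟩
    rw [div_le_iff₀ h2] at h3
    exact (Real.log_le_iff_le_exp (by linarith)).1 h3
  -- Suppose the bound fails at a point with `F ≤ 1`. Combine `p` copies of `(k, z)` with `m` copies
  -- of a point `(l, w)` of nearly optimal slope, `m` being just large enough to bring the total
  -- offset `m * e - p * d` into `[0, e]`. The combined point lies where `F ≤ 1`, while
  -- supermultiplicativity forces `F > 1` there.
  by_contra! hcon
  have hF : 0 < F k z := lt_trans (Real.exp_pos _) hcon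
  have hcon' : s * (z - k * x') < Real.log (F k z) := (Real.lt_log_iff_exp_lt hF).2 hcon
  have hlog0 : Real.log (F k z) ≤ 0 := Real.log_nonpos hF.le h1
  obtain ⟨d, hd⟩ : ∃ d, d = k * x' - z := ⟨_, rfl⟩
  obtain ⟨δ, hδ⟩ : ∃ δ, δ = Real.log (F k z) + s * d := ⟨_, rfl⟩
  have hδpos : 0 < δ := by rw [hδ, hd]; nlinarith
  have hdpos : 0 < d := by
    by_contra! h
    nlinarith
  obtain ⟨ε, hε⟩ : ∃ ε, ε = δ / (2 * d) := ⟨_, rfl⟩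
  have hεpos : 0 < ε := by rw [hε]; positivity
  have hεd : ε * d = δ / 2 := by rw [hε]; field_simp
  obtain ⟨q, ⟨l, w, hlw, rfl⟩, hq⟩ := exists_lt_of_lt_csSup hTne (show s - ε < sSup T by linarith)
  have hepos := (hpos l w hlw).2
  have hl := (hlt l w hlw).1
  obtain ⟨e, he⟩ : ∃ e, e = w - l * x' := ⟨_, rfl⟩
  rw [← he] at hq hepos
  rw [lt_div_iff₀ hepos] at hq
  -- The first bound yields `e ≤ (x - x') * m`, which absorbs the rounding in `m`; the second makes
  -- the gain `p * δ / 2` exceed the loss `ε * e`.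
  obtain ⟨p, hp⟩ := exists_nat_gt (max (e ^ 2 / ((x - x') * d)) (2 * ε * e / δ))
  have hp1 : e ^ 2 < p * ((x - x') * d) :=
    (div_lt_iff₀ (by positivity)).1 (lt_of_le_of_lt (le_max_left _ _) hp)
  have hp2 : 2 * ε * e < p * δ := (div_lt_iff₀ hδpos).1 (lt_of_le_of_lt (le_max_right _ _) hp)
  obtain ⟨m, hm⟩ : ∃ m, m = ⌈(p : ℝ) * d / e⌉₊ := ⟨_, rfl⟩
  have hm1 : (p : ℝ) * d ≤ m * e := by
    rw [← div_le_iff₀ hepos, hm]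
    exact Nat.le_ceil _
  have hm2 : (m : ℝ) * e ≤ p * d + e := by
    have : (m : ℝ) < p * d / e + 1 := by
      rw [hm]
      exact Nat.ceil_lt_add_one (by positivity)
    calc (m : ℝ) * e ≤ (p * d / e + 1) * e := by gcongr
      _ = p * d + e := by field_simp
  have hupper : F (p * k + m * l) (p * z + m * w) ≤ 1 := by
    refine le_trans (hmono _ ?_) (hle (p * k + m * l))
    push_cast
    have h4 : e ≤ (x - x') * m := by
      have : e * e ≤ (x - x') * m * e := by nlinarith
      exact le_of_mul_le_mul_right this hepos
    have h5 : (x - x') * m ≤ (x - x') * (p * k + m * l) := by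
      have : (m : ℝ) ≤ m * l := le_mul_of_one_le_right (by positivity) (by exact_mod_cast hl)
      have : (0 : ℝ) ≤ p * k := by positivity
      gcongr
      linarith
    have h6 : (p : ℝ) * z + m * w - (p * k + m * l) * x' = m * e - p * d := by
      rw [he, hd]; ring
    nlinarith
  have hlower : F k z ^ p * F l w ^ m ≤ F (p * k + m * l) (p * z + m * w) :=
    (mul_le_mul (pow_le_of_superadditive hF0 hone hsup k z p)
      (pow_le_of_superadditive hF0 hone hsup l w m) (pow_nonneg (hF0 _ _) _) (hF0 _ _)).trans
      (hsup _ _ _ _)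
  have hlwpos : 0 < F l w := by linarith
  have hlog : p * Real.log (F k z) + m * Real.log (F l w) ≤ 0 := by
    rw [← Real.log_pow, ← Real.log_pow, ← Real.log_mul (by positivity) (by positivity)]
    exact Real.log_nonpos (by positivity) (hlower.trans hupper)
  have h7 : (m : ℝ) * ((s - ε) * e) ≤ m * Real.log (F l w) := by gcongr
  have h8 : Real.log (F k z) = δ - s * d := by rw [hδ]; ring
  rw [h8] at hlog
  have h9 : s * (p * d) ≤ s * (m * e) := by gcongr
  have h10 : ε * (m * e) ≤ ε * (p * d + e) := by gcongr
  have h11 : ε * (p * d) = p * δ / 2 := by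
    rw [mul_left_comm, hεd]; ring
  nlinarith

/-- A measure with an exponential bound on its distribution function has a Laplace transform. -/
theorem lintegral_exp_le_of_Iic_le {K : Measure ℝ} {s s' a β : ℝ} (hs' : 0 < s') (hs : s' < s)
    (hK : ∀ z, K (Set.Iic z) ≤ ENNReal.ofReal (Real.exp (s * (z - a))))
    (huniv : K Set.univ ≤ ENNReal.ofReal (Real.exp β)) :
    ∫⁻ y, ENNReal.ofReal (Real.exp (-(s' * y))) ∂K ≤
      ENNReal.ofReal ((1 + Real.exp s' * (1 - Real.exp (-(s - s')))⁻¹) *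
        Real.exp (-(s' * a) + (s - s') * β / s)) := by
  have hs0 : 0 < s := hs'.trans hs
  -- The two bounds on `K`, `exp (s * (z - a))` and `exp β`, agree at `zs`. To the right the total
  -- mass is used; to the left, unit cells contribute a geometric series of ratio `exp (-(s - s'))`.
  obtain ⟨zs, hzs⟩ : ∃ zs, zs = a + β / s := ⟨_, rfl⟩
  obtain ⟨E, hE⟩ : ∃ E, E = -(s' * a) + (s - s') * β / s := ⟨_, rfl⟩
  have hE1 : -(s' * zs) + β = E := by rw [hzs, hE]; field_simp; ring
  have hE2 : ∀ n : ℕ, -(s' * (zs - n - 1)) + s * (zs - n - a) = E + s' - (s - s') * n := by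
    intro n
    rw [hzs, hE]; field_simp; ring
  obtain ⟨r, hr⟩ : ∃ r, r = Real.exp (-(s - s')) := ⟨_, rfl⟩
  have hr0 : 0 ≤ r := by rw [hr]; positivity
  have hr1 : r < 1 := by rw [hr, Real.exp_lt_one_iff]; linarith
  have hpt : ∀ y : ℝ, ENNReal.ofReal (Real.exp (-(s' * y))) ≤
      ENNReal.ofReal (Real.exp (-(s' * zs))) + ∑' n : ℕ, (Set.Iic (zs - n)).indicator
        (fun _ => ENNReal.ofReal (Real.exp (-(s' * (zs - n - 1))))) y := by
    intro y
    rcases lt_or_ge zs y with h | h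
    · refine le_add_right (ENNReal.ofReal_le_ofReal (Real.exp_le_exp.2 ?_))
      nlinarith
    · refine le_add_left (le_trans ?_ (ENNReal.le_tsum ⌊zs - y⌋₊))
      have h1 : (⌊zs - y⌋₊ : ℝ) ≤ zs - y := Nat.floor_le (by linarith)
      have h2 : zs - y < ⌊zs - y⌋₊ + 1 := Nat.lt_floor_add_one _
      rw [Set.indicator_of_mem (show y ∈ Set.Iic (zs - (⌊zs - y⌋₊ : ℝ)) by
        rw [Set.mem_Iic]; linarith)]
      refine ENNReal.ofReal_le_ofReal (Real.exp_le_exp.2 ?_)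
      nlinarith
  calc ∫⁻ y, ENNReal.ofReal (Real.exp (-(s' * y))) ∂K
      ≤ ∫⁻ y, (ENNReal.ofReal (Real.exp (-(s' * zs))) + ∑' n : ℕ, (Set.Iic (zs - n)).indicator
        (fun _ => ENNReal.ofReal (Real.exp (-(s' * (zs - n - 1))))) y) ∂K := lintegral_mono hpt
    _ = ENNReal.ofReal (Real.exp (-(s' * zs))) * K Set.univ +
        ∑' n : ℕ, ENNReal.ofReal (Real.exp (-(s' * (zs - n - 1)))) * K (Set.Iic (zs - n)) := by
      rw [lintegral_add_left measurable_const, lintegral_const,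
        lintegral_tsum fun n => (measurable_const.indicator measurableSet_Iic).aemeasurable]
      simp_rw [lintegral_indicator_const measurableSet_Iic]
    _ ≤ ENNReal.ofReal (Real.exp (-(s' * zs))) * ENNReal.ofReal (Real.exp β) +
        ∑' n : ℕ, ENNReal.ofReal (Real.exp (-(s' * (zs - n - 1)))) *
          ENNReal.ofReal (Real.exp (s * (zs - n - a))) := by
      gcongr
      exact hK _
    _ = ENNReal.ofReal (Real.exp E) +
        ∑' n : ℕ, ENNReal.ofReal (Real.exp E * Real.exp s' * r ^ n) := by
      rw [← ENNReal.ofReal_mul (Real.exp_pos _).le, ← Real.exp_add, hE1]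
      congr 2
      funext n
      rw [← ENNReal.ofReal_mul (Real.exp_pos _).le, ← Real.exp_add, hE2, hr, ← Real.exp_nat_mul,
        ← Real.exp_add, ← Real.exp_add]
      congr 2
      ring
    _ = ENNReal.ofReal ((1 + Real.exp s' * (1 - r)⁻¹) * Real.exp E) := by
      rw [← ENNReal.ofReal_tsum_of_nonneg (fun n => by positivity)
        ((summable_geometric_of_lt_one hr0 hr1).mul_left _), tsum_mul_left,
        tsum_geometric_of_lt_one hr0 hr1, ← ENNReal.ofReal_add (by positivity)
        (mul_nonneg (by positivity) (inv_nonneg.2 (by linarith)))]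
      congr 1
      ring
    _ = _ := by rw [hr, hE]

end Superadditive

/-! ### The rate function and its crossing of the level one. -/

section Rate

variable {b : ℕ} {Ω₀ : Type*} [MeasurableSpace Ω₀] {P₀ : Measure Ω₀}
  {η : Fin b → Fin b → Ω₀ → ℝ}

lemma momentMatrix_pos [IsProbabilityMeasure P₀] {s : ℝ} (hs : s ∈ expDomain η P₀) (i j : Fin b) :
    0 < momentMatrix η P₀ s i j :=
  integral_exp_pos (hs i j)

/-- Jensen's inequality, by integrating the tangent line of the exponential at `-(s * a)`. -/
lemma exp_integral_le_momentMatrix [IsProbabilityMeasure P₀]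
    (hη : ∀ i j, Integrable (fun ω => η i j ω) P₀) {s : ℝ} (hs : s ∈ expDomain η P₀) (i j : Fin b) :
    Real.exp (-(s * ∫ ω, η i j ω ∂P₀)) ≤ momentMatrix η P₀ s i j := by
  set a := ∫ ω, η i j ω ∂P₀ with ha
  have hsub : Integrable (fun ω => s * a - s * η i j ω) P₀ :=
    (integrable_const _).sub ((hη i j).const_mul s)
  have hint : Integrable (fun ω => Real.exp (-(s * a)) * (1 + (s * a - s * η i j ω))) P₀ :=
    ((integrable_const _).add hsub).const_mul _
  calc Real.exp (-(s * a)) = ∫ ω, Real.exp (-(s * a)) * (1 + (s * a - s * η i j ω)) ∂P₀ := by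
        rw [integral_const_mul, integral_add (integrable_const _) hsub,
          integral_sub (integrable_const _) ((hη i j).const_mul s)]
        simp only [integral_const_mul, integral_const, ← ha, probReal_univ, smul_eq_mul]
        ring
    _ ≤ ∫ ω, Real.exp (-(s * η i j ω)) ∂P₀ := by
        refine integral_mono hint (hs i j) fun ω => ?_
        have h1 := Real.add_one_le_exp (s * a - s * η i j ω)
        calc Real.exp (-(s * a)) * (1 + (s * a - s * η i j ω))
            ≤ Real.exp (-(s * a)) * Real.exp (s * a - s * η i j ω) := by
              gcongr
              linarith
          _ = _ := by rw [← Real.exp_add]; congr 1; ring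

lemma rho_of_mem {s : ℝ} (hs : s ∈ expDomain η P₀) :
    rho η P₀ s = ENNReal.ofReal (largestEigenvalue (momentMatrix η P₀ s)) := if_pos hs

lemma lam_le {s : ℝ} (hs : 0 ≤ s) (x : ℝ) :
    lam η P₀ x ≤ ENNReal.ofReal (Real.exp (s * x)) * rho η P₀ s :=
  iInf₂_le s hs

lemma lam_mono : Monotone (lam η P₀) := fun x y hxy =>
  le_iInf₂ fun s hs => (lam_le hs x).trans <| by gcongr

/-- Once `x` exceeds all the means, Jensen bounds every entry of the moment matrix below by `exp
(-(s * x))`, hence its largest eigenvalue by `b` times that, whatever `s`. -/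
lemma exists_le_lam [IsProbabilityMeasure P₀] (hb : 0 < b)
    (hη : ∀ i j, Integrable (fun ω => η i j ω) P₀) :
    ∃ C : ℝ, ∀ x, C ≤ x → (b : ℝ≥0∞) ≤ lam η P₀ x := by
  obtain ⟨C, hC⟩ := Finite.bddAbove_range fun p : Fin b × Fin b => ∫ ω, η p.1 p.2 ω ∂P₀
  refine ⟨C, fun x hx => le_iInf₂ fun s hs => ?_⟩
  by_cases hD : s ∈ expDomain η P₀
  · rw [rho_of_mem hD, ← ENNReal.ofReal_mul (Real.exp_pos _).le, ← ENNReal.ofReal_natCast]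
    refine ENNReal.ofReal_le_ofReal ?_
    have h1 : b * Real.exp (-(s * x)) ≤ largestEigenvalue (momentMatrix η P₀ s) := by
      refine le_largestEigenvalue hb (momentMatrix_pos hD) fun i j => ?_
      refine le_trans (Real.exp_le_exp.2 ?_) (exp_integral_le_momentMatrix hη hD i j)
      have : ∫ ω, η i j ω ∂P₀ ≤ x := (hC ⟨(i, j), rfl⟩).trans hx
      have := mul_le_mul_of_nonneg_left this hs
      linarith
    calc (b : ℝ) = Real.exp (s * x) * (b * Real.exp (-(s * x))) := by
          rw [mul_left_comm, ← Real.exp_add]; simp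
      _ ≤ _ := by gcongr
  · rw [rho, if_neg hD, ENNReal.mul_top (by simp [Real.exp_pos])]
    exact le_top

lemma exists_lam_lt_one (h1 : (1 : ℝ) ∈ expDomain η P₀) : ∃ x, lam η P₀ x < 1 := by
  set r := largestEigenvalue (momentMatrix η P₀ 1) with hr
  refine ⟨-(|r|), (lam_le zero_le_one _).trans_lt ?_⟩
  rw [rho_of_mem h1, ← ENNReal.ofReal_mul (Real.exp_pos _).le, ENNReal.ofReal_lt_one, one_mul,
    Real.exp_neg, inv_mul_lt_iff₀ (Real.exp_pos _), mul_one]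
  linarith [Real.add_one_le_exp |r|, le_abs_self r]

/-- For each `s` the function under the infimum is log-affine in `x`. Powers are used instead of
logarithms because `lam` may be `0` or infinite. -/
lemma lam_logConcave {θ : ℝ} (h0 : 0 ≤ θ) (h1 : θ ≤ 1) (x y : ℝ) :
    lam η P₀ x ^ θ * lam η P₀ y ^ (1 - θ) ≤ lam η P₀ (θ * x + (1 - θ) * y) := by
  have h1' : 0 ≤ 1 - θ := by linarith
  refine le_iInf₂ fun s hs => ?_
  calc lam η P₀ x ^ θ * lam η P₀ y ^ (1 - θ)
      ≤ (ENNReal.ofReal (Real.exp (s * x)) * rho η P₀ s) ^ θ *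
        (ENNReal.ofReal (Real.exp (s * y)) * rho η P₀ s) ^ (1 - θ) :=
        mul_le_mul' (ENNReal.rpow_le_rpow (lam_le hs x) h0) (ENNReal.rpow_le_rpow (lam_le hs y) h1')
    _ = (ENNReal.ofReal (Real.exp (s * x)) ^ θ * ENNReal.ofReal (Real.exp (s * y)) ^ (1 - θ)) *
        (rho η P₀ s ^ θ * rho η P₀ s ^ (1 - θ)) := by
        rw [ENNReal.mul_rpow_of_nonneg _ _ h0, ENNReal.mul_rpow_of_nonneg _ _ h1', mul_mul_mul_comm]
    _ = _ := by
        rw [← ENNReal.rpow_add_of_nonneg _ _ h0 h1', add_sub_cancel, ENNReal.rpow_one,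
          ENNReal.ofReal_rpow_of_pos (Real.exp_pos _), ENNReal.ofReal_rpow_of_pos (Real.exp_pos _),
          ← ENNReal.ofReal_mul (by positivity), ← Real.exp_mul, ← Real.exp_mul, ← Real.exp_add]
        congr 3
        ring

/-- The function `lam` crosses the level `1` at exactly one point. -/
theorem exists_lam_crossing [IsProbabilityMeasure P₀] (hb : 2 ≤ b) (hη : Regular η P₀) :
    ∃ x₀ : ℝ, (∀ x, x < x₀ → lam η P₀ x < 1) ∧ ∀ x, x₀ < x → 1 < lam η P₀ x := by
  obtain ⟨C, hC⟩ := exists_le_lam (by omega) hη.integrable_log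
  have hb1 : (1 : ℝ≥0∞) < b := by exact_mod_cast hb
  set S : Set ℝ := {x | lam η P₀ x < 1} with hS
  have hSne : S.Nonempty := exists_lam_lt_one (hη.unitInterval_subset ⟨zero_le_one, le_rfl⟩)
  have hbdd : BddAbove S := ⟨C, fun x hx => le_of_not_gt fun h =>
    absurd (hb1.trans_le (hC x h.le)) (not_lt.2 (le_of_lt hx))⟩
  refine ⟨sSup S, fun x hx => ?_, fun x hx => ?_⟩
  · obtain ⟨y, hy, hxy⟩ := exists_lt_of_lt_csSup hSne hx
    exact (lam_mono hxy.le).trans_lt hy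
  · obtain ⟨y, hy1, hy2⟩ := exists_between hx
    have hy : 1 ≤ lam η P₀ y := not_lt.1 fun h => absurd (le_csSup hbdd h) (not_le.2 hy1)
    obtain ⟨Z, hZ1, hZ2⟩ : ∃ Z, C ≤ Z ∧ x < Z :=
      ⟨max C (x + 1), le_max_left _ _, (lt_add_one x).trans_le (le_max_right _ _)⟩
    have hyZ : 0 < Z - y := by linarith
    set θ := (Z - x) / (Z - y) with hθ
    have hθ0 : 0 < θ := div_pos (by linarith) hyZ
    have hθ1 : θ < 1 := (div_lt_one hyZ).2 (by linarith)
    have hx' : θ * y + (1 - θ) * Z = x := by rw [hθ]; field_simp; ring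
    calc (1 : ℝ≥0∞) < (b : ℝ≥0∞) ^ (1 - θ) := ENNReal.one_lt_rpow hb1 (by linarith)
      _ ≤ lam η P₀ Z ^ (1 - θ) := ENNReal.rpow_le_rpow (hC Z hZ1) (by linarith)
      _ ≤ lam η P₀ y ^ θ * lam η P₀ Z ^ (1 - θ) :=
          le_mul_of_one_le_left (by positivity) (ENNReal.one_le_rpow hy hθ0)
      _ ≤ lam η P₀ x := by
          have := lam_logConcave (η := η) (P₀ := P₀) hθ0.le hθ1.le y Z
          rwa [hx'] at this

/-- At the crossing point `lam` takes the value `1`, unless it jumps there from `0`. -/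
theorem lam_crossing_eq_one {x₀ x : ℝ} (hlt : ∀ x, x < x₀ → lam η P₀ x < 1)
    (hgt : ∀ x, x₀ < x → 1 < lam η P₀ x) (hx0 : 0 < lam η P₀ x) (hx1 : lam η P₀ x ≤ 1) :
    lam η P₀ x₀ = 1 := by
  refine le_antisymm ?_ (le_iInf₂ fun s hs => ?_)
  · by_contra! hcon
    have hxx : x < x₀ := by
      rcases lt_trichotomy x x₀ with h | h | h
      · exact h
      · rw [h] at hx1
        exact absurd hcon (not_lt.2 hx1)
      · exact absurd (hgt x h) (not_lt.2 hx1)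
    obtain ⟨a, ha⟩ : ∃ a, a = (lam η P₀ x).toReal := ⟨_, rfl⟩
    have hxtop : lam η P₀ x ≠ ⊤ := ne_top_of_le_ne_top ENNReal.one_ne_top hx1
    have hxa : lam η P₀ x = ENNReal.ofReal a := by rw [ha, ENNReal.ofReal_toReal hxtop]
    have ha0 : 0 < a := by rw [ha]; exact ENNReal.toReal_pos hx0.ne' hxtop
    have ha1 : a < 1 := by
      have := hlt x hxx
      rwa [hxa, ENNReal.ofReal_lt_one] at this
    -- The real `c` stands in for `lam x₀`, which may be infinite. The weight `θ` below makes the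
    -- geometric mean of `a` and `c` equal to `1`, which requires `a > 0`; then `lam ≥ 1` at a point
    -- left of `x₀`.
    obtain ⟨c, hc1, hc2⟩ : ∃ c : ℝ, 1 < c ∧ ENNReal.ofReal c ≤ lam η P₀ x₀ := by
      obtain ⟨c, -, h1, h2⟩ := ENNReal.lt_iff_exists_real_btwn.1 hcon
      exact ⟨c, by rwa [ENNReal.one_lt_ofReal] at h1, h2.le⟩
    have hla := Real.log_neg ha0 ha1
    have hlc := Real.log_pos hc1
    have hden : 0 < Real.log c - Real.log a := by linarith
    obtain ⟨θ, hθ⟩ : ∃ θ, θ = Real.log c / (Real.log c - Real.log a) := ⟨_, rfl⟩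
    have hθ0 : 0 < θ := by rw [hθ]; positivity
    have hθ1 : θ < 1 := by rw [hθ, div_lt_one hden]; linarith
    have hval : a ^ θ * c ^ (1 - θ) = 1 := by
      rw [Real.rpow_def_of_pos ha0, Real.rpow_def_of_pos (by linarith), ← Real.exp_add,
        Real.exp_eq_one_iff, hθ]
      field_simp
      ring
    have h1 : lam η P₀ (θ * x + (1 - θ) * x₀) < 1 := hlt _ (by nlinarith)
    have h2 := lam_logConcave (η := η) (P₀ := P₀) hθ0.le hθ1.le x x₀
    have h3 : (1 : ℝ≥0∞) ≤ lam η P₀ x ^ θ * lam η P₀ x₀ ^ (1 - θ) :=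
      calc (1 : ℝ≥0∞) = ENNReal.ofReal a ^ θ * ENNReal.ofReal c ^ (1 - θ) := by
            rw [ENNReal.ofReal_rpow_of_pos ha0, ENNReal.ofReal_rpow_of_pos (by linarith),
              ← ENNReal.ofReal_mul (by positivity), hval, ENNReal.ofReal_one]
        _ ≤ _ := by
            rw [hxa]
            gcongr
    exact absurd (h3.trans h2) (not_le.2 h1)
  · have hne : ENNReal.ofReal (Real.exp (s * x₀)) ≠ 0 := by simp [Real.exp_pos]
    by_cases hr : rho η P₀ s = ⊤
    · rw [hr, ENNReal.mul_top hne]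
      exact le_top
    -- For fixed `s` with finite `rho`, the bound by `1` valid on the right of `x₀` passes to the
    -- limit.
    have hcont : Continuous fun y : ℝ => ENNReal.ofReal (Real.exp (s * y)) * rho η P₀ s :=
      (ENNReal.continuous_mul_const hr).comp (ENNReal.continuous_ofReal.comp (by fun_prop))
    refine ge_of_tendsto ((hcont.tendsto x₀).mono_left (nhdsWithin_le_nhds (s := Set.Ioi x₀))) ?_
    filter_upwards [self_mem_nhdsWithin] with y hy
    exact (hgt y hy).le.trans (lam_le hs y)

end Rate

/-! ### Mean measures of the particle positions. -/

section MeanMeasure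

variable {b : ℕ}

/-- The mean measure of the positions of the particles of type `j` in generation `k`, for a walk
started from one particle of type `i` with displacement laws `τ`. -/
noncomputable def meanMeasure (τ : Fin b → Fin b → Measure ℝ) :
    ℕ → Fin b → Fin b → Measure ℝ
  | 0, i, j => if i = j then Measure.dirac 0 else 0
  | k + 1, i, j => ∑ m, (meanMeasure τ k i m).conv (τ m j)

variable {τ : Fin b → Fin b → Measure ℝ} [∀ i j, IsProbabilityMeasure (τ i j)]

lemma lintegral_meanMeasure_succ (k : ℕ) (i j : Fin b) {f : ℝ → ℝ≥0∞} (hf : Measurable f) :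
    ∫⁻ z, f z ∂meanMeasure τ (k + 1) i j =
      ∑ m, ∫⁻ x, ∫⁻ y, f (x + y) ∂τ m j ∂meanMeasure τ k i m := by
  rw [meanMeasure, lintegral_finsetSum_measure]
  exact Finset.sum_congr rfl fun m _ => Measure.lintegral_conv hf

lemma meanMeasure_univ_le (k : ℕ) (i j : Fin b) :
    meanMeasure τ k i j Set.univ ≤ (b : ℝ≥0∞) ^ k := by
  induction k generalizing j with
  | zero =>
    rw [meanMeasure]
    split_ifs <;> simp
  | succ k ih =>
    rw [← lintegral_one, lintegral_meanMeasure_succ k i j measurable_const]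
    calc ∑ m, ∫⁻ _, ∫⁻ _, 1 ∂τ m j ∂meanMeasure τ k i m
        = ∑ m, meanMeasure τ k i m Set.univ := by simp
      _ ≤ ∑ _m : Fin b, (b : ℝ≥0∞) ^ k := Finset.sum_le_sum fun m _ => ih m
      _ = (b : ℝ≥0∞) ^ (k + 1) := by simp [pow_succ, mul_comm]

instance instIsFiniteMeasureMeanMeasure (k : ℕ) (i j : Fin b) :
    IsFiniteMeasure (meanMeasure τ k i j) :=
  ⟨(meanMeasure_univ_le k i j).trans_lt (ENNReal.pow_lt_top (ENNReal.natCast_lt_top b))⟩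

/-- Generation `2` is the first with `b > 1` particles of each type; it supplies a mean count above
`1` for the supporting-line argument. -/
lemma meanMeasure_two_univ (i j : Fin b) : meanMeasure τ 2 i j Set.univ = b := by
  have h1 : ∀ k i j, meanMeasure τ (k + 1) i j Set.univ =
      ∑ m, meanMeasure τ k i m Set.univ := fun k i j => by
    rw [← lintegral_one, lintegral_meanMeasure_succ k i j measurable_const]
    simp
  have h0 : ∀ i j, meanMeasure τ 1 i j Set.univ = 1 := fun i j => by
    rw [h1 0, Finset.sum_eq_single i (fun m _ hm => by simp [meanMeasure, Ne.symm hm])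
      (by simp)]
    simp [meanMeasure]
  rw [h1 1]
  simp [h0]

/-- The Laplace transform turns convolution into multiplication. Entries in `ℝ≥0∞` allow every `s`,
also outside the domain. -/
lemma lintegral_exp_meanMeasure (s : ℝ) (k : ℕ) (i j : Fin b) :
    ∫⁻ z, ENNReal.ofReal (Real.exp (-(s * z))) ∂meanMeasure τ k i j =
      ((Matrix.of fun i j => ∫⁻ z, ENNReal.ofReal (Real.exp (-(s * z))) ∂τ i j) ^ k) i j := by
  have hmeas : Measurable fun z : ℝ => ENNReal.ofReal (Real.exp (-(s * z))) := by fun_prop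
  induction k generalizing j with
  | zero =>
    rw [pow_zero, Matrix.one_apply, meanMeasure]
    split_ifs <;> simp
  | succ k ih =>
    rw [lintegral_meanMeasure_succ k i j hmeas, pow_succ, Matrix.mul_apply]
    refine Finset.sum_congr rfl fun m _ => ?_
    rw [← ih m, Matrix.of_apply, ← lintegral_mul_const _ hmeas]
    refine lintegral_congr fun x => ?_
    rw [← lintegral_const_mul _ hmeas]
    refine lintegral_congr fun y => ?_
    rw [← ENNReal.ofReal_mul (Real.exp_pos _).le, ← Real.exp_add]
    ring_nf

lemma meanMeasure_succ_Iic (k : ℕ) (i j : Fin b) (z : ℝ) :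
    meanMeasure τ (k + 1) i j (Set.Iic z) =
      ∑ m, ∫⁻ y, meanMeasure τ k i m (Set.Iic (z - y)) ∂τ m j := by
  have hmeas : Measurable ((Set.Iic z).indicator (1 : ℝ → ℝ≥0∞)) :=
    measurable_one.indicator measurableSet_Iic
  rw [meanMeasure, Measure.finsetSum_apply]
  refine Finset.sum_congr rfl fun m _ => ?_
  rw [Measure.conv_comm, ← lintegral_indicator_one measurableSet_Iic, Measure.lintegral_conv hmeas]
  refine lintegral_congr fun y => ?_
  rw [← lintegral_indicator_one measurableSet_Iic]
  refine lintegral_congr fun x => ?_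
  simp only [Set.indicator, Set.mem_Iic, le_sub_iff_add_le, add_comm, Pi.one_apply]

/-- Only lineages passing through type `m` in generation `k` at most at `z`, and moving at most `w`
afterwards, are counted on the left. Integrating the last step outermost lets the induction
hypothesis apply at `w - y`. -/
lemma meanMeasure_Iic_mul_le (k l : ℕ) (i m j : Fin b) (z w : ℝ) :
    meanMeasure τ k i m (Set.Iic z) * meanMeasure τ l m j (Set.Iic w) ≤
      meanMeasure τ (k + l) i j (Set.Iic (z + w)) := by
  induction l generalizing j w with
  | zero =>
    rw [add_zero]
    rw [show meanMeasure τ 0 m j = if m = j then Measure.dirac 0 else 0 from rfl]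
    split_ifs with h
    · subst h
      rw [Measure.dirac_apply' _ measurableSet_Iic]
      by_cases hw : 0 ≤ w
      · simp only [Set.indicator, Set.mem_Iic, hw, if_true, Pi.one_apply, mul_one]
        exact measure_mono (Set.Iic_subset_Iic.2 (by linarith))
      · simp [hw]
    · simp
  | succ l ih =>
    rw [← add_assoc, meanMeasure_succ_Iic, meanMeasure_succ_Iic, Finset.mul_sum]
    refine Finset.sum_le_sum fun n _ => ?_
    refine (lintegral_const_mul_le _ _).trans (lintegral_mono fun y => ?_)
    rw [add_sub_assoc]
    exact ih n (w - y)

end MeanMeasure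

/-! ### The Cramér-type lower bound for the means. -/

section Cramer

variable {b : ℕ} {Ω₀ : Type*} [MeasurableSpace Ω₀] {P₀ : Measure Ω₀}
  {η : Fin b → Fin b → Ω₀ → ℝ}

/-- The law of the displacement from a particle of type `i` to its child of type `j`. -/
noncomputable def stepLaw (η : Fin b → Fin b → Ω₀ → ℝ) (P₀ : Measure Ω₀) (i j : Fin b) :
    Measure ℝ :=
  P₀.map (η i j)

lemma isProbabilityMeasure_stepLaw [IsProbabilityMeasure P₀]
    (hη : ∀ i j, AEMeasurable (η i j) P₀) (i j : Fin b) :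
    IsProbabilityMeasure (stepLaw η P₀ i j) :=
  Measure.isProbabilityMeasure_map (hη i j)

lemma lintegral_exp_stepLaw (hη : ∀ i j, AEMeasurable (η i j) P₀) (s : ℝ) (i j : Fin b) :
    ∫⁻ z, ENNReal.ofReal (Real.exp (-(s * z))) ∂stepLaw η P₀ i j =
      ∫⁻ ω, ENNReal.ofReal (Real.exp (-(s * η i j ω))) ∂P₀ :=
  lintegral_map' (by fun_prop) (hη i j)

lemma mem_expDomain_iff (hη : ∀ i j, AEMeasurable (η i j) P₀) (s : ℝ) :
    s ∈ expDomain η P₀ ↔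
      ∀ i j, ∫⁻ z, ENNReal.ofReal (Real.exp (-(s * z))) ∂stepLaw η P₀ i j ≠ ⊤ := by
  refine forall₂_congr fun i j => ?_
  rw [lintegral_exp_stepLaw hη,
    ← lintegral_ofReal_ne_top_iff_integrable]
  · exact (Real.measurable_exp.comp_aemeasurable ((hη i j).const_mul s).neg).aestronglyMeasurable
  · exact Eventually.of_forall fun ω => (Real.exp_pos _).le

/-- For `s` in the domain, the Laplace transform of the mean measures is a matrix power. -/
lemma lintegral_exp_meanMeasure_stepLaw [IsProbabilityMeasure P₀]
    (hη : ∀ i j, AEMeasurable (η i j) P₀) {s : ℝ} (hs : s ∈ expDomain η P₀)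
    (k : ℕ) (i j : Fin b) :
    ∫⁻ z, ENNReal.ofReal (Real.exp (-(s * z))) ∂meanMeasure (stepLaw η P₀) k i j =
      ENNReal.ofReal ((momentMatrix η P₀ s ^ k) i j) := by
  have := isProbabilityMeasure_stepLaw hη
  have hM : (Matrix.of fun i j => ∫⁻ z, ENNReal.ofReal (Real.exp (-(s * z))) ∂stepLaw η P₀ i j) =
      Matrix.of fun i j => ENNReal.ofReal (momentMatrix η P₀ s i j) := by
    ext i j
    rw [Matrix.of_apply, Matrix.of_apply, lintegral_exp_stepLaw hη]
    exact (ofReal_integral_eq_lintegral_ofReal (hs i j)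
      (Eventually.of_forall fun ω => (Real.exp_pos _).le)).symm
  rw [lintegral_exp_meanMeasure, hM]
  induction k generalizing j with
  | zero => rw [pow_zero, pow_zero, Matrix.one_apply, Matrix.one_apply]; split_ifs <;> simp
  | succ k ih =>
    have hpos := momentMatrix_pos hs
    rw [pow_succ, pow_succ, Matrix.mul_apply, Matrix.mul_apply, ENNReal.ofReal_sum_of_nonneg
      fun l _ => mul_nonneg (pow_apply_nonneg hpos k i l) (hpos l j).le]
    refine Finset.sum_congr rfl fun l _ => ?_
    rw [ih, Matrix.of_apply, ENNReal.ofReal_mul (pow_apply_nonneg hpos k i l)]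

/-- A path `i → j → l → i` has three steps, so each entry `M j l` enters the diagonal of the cube
with nonzero factors, and an infinite entry would make it infinite. -/
lemma mem_expDomain_of_pow_ne_top [IsProbabilityMeasure P₀]
    (hη : ∀ i j, AEMeasurable (η i j) P₀) {s : ℝ} {i : Fin b}
    (h : ∫⁻ z, ENNReal.ofReal (Real.exp (-(s * z))) ∂meanMeasure (stepLaw η P₀) 3 i i ≠ ⊤) :
    s ∈ expDomain η P₀ := by
  have := isProbabilityMeasure_stepLaw hη
  rw [mem_expDomain_iff hη]
  intro j l htop
  refine h ?_
  rw [lintegral_exp_meanMeasure]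
  set M : Matrix (Fin b) (Fin b) ℝ≥0∞ :=
    Matrix.of fun i j => ∫⁻ z, ENNReal.ofReal (Real.exp (-(s * z))) ∂stepLaw η P₀ i j with hM
  have hne : ∀ i j, M i j ≠ 0 := by
    intro i j h0
    rw [hM, Matrix.of_apply, lintegral_eq_zero_iff (by fun_prop)] at h0
    obtain ⟨z, hz⟩ := h0.exists
    simp only [Pi.zero_apply, ENNReal.ofReal_eq_zero] at hz
    exact absurd (Real.exp_pos _) (not_lt.2 hz)
  have hMjl : M j l = ⊤ := htop
  rw [pow_succ, pow_two, Matrix.mul_apply]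
  refine top_unique (le_trans ?_ (Finset.single_le_sum (fun _ _ => zero_le) (Finset.mem_univ l)))
  have h2 : (M * M) i l = ⊤ := by
    rw [Matrix.mul_apply]
    refine top_unique (le_trans ?_
      (Finset.single_le_sum (fun _ _ => zero_le) (Finset.mem_univ j)))
    rw [hMjl, ENNReal.mul_top (hne i j)]
  rw [h2, ENNReal.top_mul (hne l i)]

lemma le_of_forall_mul_pow_le {c C r θ : ℝ} (hc : 0 < c) (hθ : 0 < θ)
    (h : ∀ k : ℕ, c * r ^ k ≤ C * θ ^ k) : r ≤ θ := by
  by_contra! hlt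
  have h1 : 1 < r / θ := (one_lt_div hθ).2 hlt
  obtain ⟨k, hk⟩ := pow_unbounded_of_one_lt (C / c) h1
  rw [div_pow, div_lt_div_iff₀ hc (by positivity)] at hk
  linarith [h k]

/-- If `lam` exceeds `1` to the left of `x`, then for some `k ≥ 1` the mean number of particles of
generation `k`, of the type of the initial particle and at most at `k * x`, exceeds `1`. -/
theorem exists_one_lt_meanMeasure [IsProbabilityMeasure P₀] (hb : 2 ≤ b)
    (hη : ∀ i j, AEMeasurable (η i j) P₀) {x' x : ℝ} (hx : x' < x) (hlam : 1 < lam η P₀ x')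
    (i : Fin b) :
    ∃ k : ℕ, 1 ≤ k ∧ 1 < meanMeasure (stepLaw η P₀) k i i (Set.Iic (k * x)) := by
  have := isProbabilityMeasure_stepLaw hη
  by_contra! hcon
  set K := fun k : ℕ => meanMeasure (stepLaw η P₀) k i i with hK
  have hb1 : (1 : ℝ) ≤ b := by exact_mod_cast (by omega : 1 ≤ b)
  have hreal : ∀ k z, (K k).real (Set.Iic z) ≤ (b : ℝ) ^ k := by
    intro k z
    refine ENNReal.toReal_le_of_le_ofReal (by positivity) ?_
    rw [ENNReal.ofReal_pow (by positivity), ENNReal.ofReal_natCast]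
    exact (measure_mono (Set.subset_univ _)).trans (meanMeasure_univ_le k i i)
  obtain ⟨s, hs, hbound⟩ := exists_exp_bound_of_superadditive (B := b) (x := x) (x' := x')
    (F := fun k z => (K k).real (Set.Iic z)) (fun _ _ => measureReal_nonneg)
    (by simp [hK, meanMeasure, measureReal_def])
    (fun k l z w => by
      simp only [measureReal_def, ← ENNReal.toReal_mul]
      exact ENNReal.toReal_mono (measure_ne_top _ _) (meanMeasure_Iic_mul_le k l i i i z w))
    (fun k z w hzw => measureReal_mono (Set.Iic_subset_Iic.2 hzw))
    hb1 hreal hx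
    (fun k => by
      rcases Nat.eq_zero_or_pos k with rfl | hk
      · simpa using hreal 0 _
      · exact ENNReal.toReal_le_of_le_ofReal zero_le_one (by simpa using hcon k hk))
    (by
      have h1 : Tendsto (fun z => (K 2) (Set.Iic z)) atTop (𝓝 ((K 2) Set.univ)) :=
        tendsto_measure_Iic_atTop _
      rw [show (K 2) Set.univ = b from meanMeasure_two_univ i i] at h1
      obtain ⟨z, hz⟩ := (h1.eventually_const_lt
        (show (1 : ℝ≥0∞) < b by exact_mod_cast hb)).exists
      refine ⟨2, z, ?_⟩
      rw [measureReal_def, ← ENNReal.toReal_one]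
      exact (ENNReal.toReal_lt_toReal ENNReal.one_ne_top (measure_ne_top _ _)).2 hz)
  -- The supporting line makes the Laplace transform at `s'` grow at most like `θ ^ k`; comparison
  -- with the Perron lower bound gives `ρ(s') ≤ θ`.
  have hkey : ∀ s', 0 < s' → s' < s →
      lam η P₀ x' ≤ ENNReal.ofReal (Real.exp ((s - s') * Real.log b / s)) := by
    intro s' hs'0 hs's
    obtain ⟨C, hC⟩ : ∃ C : ℝ, C = 1 + Real.exp s' * (1 - Real.exp (-(s - s')))⁻¹ := ⟨_, rfl⟩
    obtain ⟨θ, hθ⟩ : ∃ θ : ℝ, θ = Real.exp (-(s' * x') + (s - s') * Real.log b / s) := ⟨_, rfl⟩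
    have hlap : ∀ k : ℕ, ∫⁻ y, ENNReal.ofReal (Real.exp (-(s' * y))) ∂K k ≤
        ENNReal.ofReal (C * θ ^ k) := by
      intro k
      refine (lintegral_exp_le_of_Iic_le (a := k * x') (β := k * Real.log b) hs'0 hs's
        (fun z => ?_) ?_).trans (ENNReal.ofReal_le_ofReal (le_of_eq ?_))
      · rw [← ofReal_measureReal]
        exact ENNReal.ofReal_le_ofReal (hbound k z)
      · rw [Real.exp_nat_mul, Real.exp_log (by linarith), ENNReal.ofReal_pow (by positivity),
          ENNReal.ofReal_natCast]
        exact meanMeasure_univ_le k i i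
      · rw [← hC, hθ, ← Real.exp_nat_mul]
        congr 2
        ring
    have hD : s' ∈ expDomain η P₀ :=
      mem_expDomain_of_pow_ne_top hη (ne_top_of_le_ne_top ENNReal.ofReal_ne_top (hlap 3))
    have hpos := momentMatrix_pos hD
    obtain ⟨-, -, c, hc, hlow⟩ := pow_apply_bounds (by omega) hpos
    have hrθ : largestEigenvalue (momentMatrix η P₀ s') ≤ θ := by
      have hθ0 : 0 < θ := by rw [hθ]; positivity
      refine le_of_forall_mul_pow_le hc hθ0 (C := C * θ) fun k => (hlow k i).trans ?_
      have h1 := hlap (k + 1)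
      rw [hK, lintegral_exp_meanMeasure_stepLaw hη hD] at h1
      have hC0 : 0 ≤ C * θ ^ (k + 1) := by
        have : Real.exp (-(s - s')) ≤ 1 := Real.exp_le_one_iff.2 (by linarith)
        have : 0 ≤ (1 - Real.exp (-(s - s')))⁻¹ := inv_nonneg.2 (by linarith)
        rw [hC]; positivity
      rw [mul_assoc, ← pow_succ']
      exact (ENNReal.ofReal_le_ofReal_iff hC0).1 h1
    refine (lam_le hs'0.le x').trans ?_
    rw [rho_of_mem hD, ← ENNReal.ofReal_mul (Real.exp_pos _).le]
    refine ENNReal.ofReal_le_ofReal ?_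
    calc Real.exp (s' * x') * largestEigenvalue (momentMatrix η P₀ s')
        ≤ Real.exp (s' * x') * θ := by gcongr
      _ = _ := by
        rw [hθ, ← Real.exp_add]
        congr 1
        ring
  -- Nothing places `s` itself in the domain, so `s'` increases to `s`, and the bound on `lam x'`
  -- tends to `1`.
  have hcont : Continuous fun s' : ℝ => ENNReal.ofReal (Real.exp ((s - s') * Real.log b / s)) :=
    ENNReal.continuous_ofReal.comp (by fun_prop)
  have hlim := (hcont.tendsto s).mono_left (nhdsWithin_le_nhds (s := Set.Iio s))
  have hfin : lam η P₀ x' ≤ ENNReal.ofReal (Real.exp ((s - s) * Real.log b / s)) := by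
    refine ge_of_tendsto hlim ?_
    filter_upwards [Ioo_mem_nhdsLT hs] with s' hs'
    exact hkey s' hs'.1 hs'.2
  simp only [sub_self, zero_mul, zero_div, Real.exp_zero, ENNReal.ofReal_one] at hfin
  exact absurd hlam (not_lt.2 hfin)

end Cramer

/-! ### Words, generations and subtrees. -/

section Genealogy

variable {b : ℕ} {Ω : Type*}

/-- The words of length `k`, that is, the particles of generation `k`. -/
def generation (b : ℕ) : ℕ → Finset (List (Fin b))
  | 0 => {[]}
  | k + 1 => (Finset.univ ×ˢ generation b k).map
      ⟨fun p : Fin b × List (Fin b) => p.1 :: p.2, fun p q h => by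
        obtain ⟨h1, h2⟩ := List.cons.inj h
        exact Prod.ext h1 h2⟩

lemma mem_generation {k : ℕ} {v : List (Fin b)} : v ∈ generation b k ↔ v.length = k := by
  induction k generalizing v with
  | zero => simp [generation]
  | succ k ih =>
    cases v with
    | nil => simp [generation]
    | cons j v =>
      rw [generation, Finset.mem_map, List.length_cons, add_left_inj, ← ih]
      constructor
      · rintro ⟨⟨a, u⟩, hu, h⟩
        rw [← (List.cons.inj h).2]
        exact (Finset.mem_product.1 hu).2
      · exact fun hv => ⟨(j, v), Finset.mem_product.2 ⟨Finset.mem_univ j, hv⟩, rfl⟩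

lemma sum_generation_succ {M : Type*} [AddCommMonoid M] (k : ℕ) (f : List (Fin b) → M) :
    ∑ v ∈ generation b (k + 1), f v = ∑ v ∈ generation b k, ∑ j, f (j :: v) := by
  rw [generation, Finset.sum_map, Finset.sum_product_right]
  rfl

lemma card_generation (k : ℕ) : (generation b k).card = b ^ k := by
  induction k with
  | zero => rfl
  | succ k ih => rw [generation, Finset.card_map, Finset.card_product, ih, pow_succ']; simp

lemma colour_append (i : Fin b) (w v : List (Fin b)) :
    colour i (w ++ v) = colour (colour i v) w := by
  cases w <;> rfl

/-- The jumps in the subtree rooted at `v`. -/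
def subtree (J : List (Fin b) → Ω → Fin b → ℝ) (v : List (Fin b)) :
    List (Fin b) → Ω → Fin b → ℝ :=
  fun w => J (w ++ v)

/-- Words grow at the head, so `w ++ v` is the descendant of `v` reached along `w`. -/
lemma position_append (J : List (Fin b) → Ω → Fin b → ℝ) (w v : List (Fin b)) (ω : Ω) :
    position J (w ++ v) ω = position J v ω + position (subtree J v) w ω := by
  induction w with
  | nil => simp [position]
  | cons j w ih =>
    rw [List.cons_append, position, position, ih, add_assoc]
    rfl

lemma position_congr {J J' : List (Fin b) → Ω → Fin b → ℝ} {ω : Ω} (h : ∀ v, J v ω = J' v ω)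
    (v : List (Fin b)) : position J v ω = position J' v ω := by
  induction v with
  | nil => rfl
  | cons j v ih => rw [position, position, ih, h]

lemma measurable_position {m : MeasurableSpace Ω} {J : List (Fin b) → Ω → Fin b → ℝ}
    (v : List (Fin b)) (h : ∀ u : List (Fin b), u.length < v.length → Measurable (J u)) :
    Measurable (position J v) := by
  induction v with
  | nil => exact measurable_const
  | cons j v ih =>
    exact (ih fun u hu => h u (hu.trans (Nat.lt_succ_self _))).add
      ((measurable_pi_apply j).comp (h v (Nat.lt_succ_self _)))

lemma minDisplacement_le_position (J : List (Fin b) → Ω → Fin b → ℝ) {t : ℕ}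
    {v : List (Fin b)} (hv : v.length = t) (ω : Ω) :
    minDisplacement J t ω ≤ position J v ω :=
  ciInf_le (f := fun v : List.Vector (Fin b) t => position J v.toList ω)
    (Set.finite_range _).bddBelow ⟨v, hv⟩

lemma exists_position_eq_minDisplacement (hb : 0 < b) (J : List (Fin b) → Ω → Fin b → ℝ) (t : ℕ)
    (ω : Ω) : ∃ v ∈ generation b t, position J v ω = minDisplacement J t ω := by
  have : Nonempty (List.Vector (Fin b) t) := ⟨List.Vector.replicate t ⟨0, hb⟩⟩
  obtain ⟨v, hv⟩ :=
    exists_eq_ciInf_of_finite (f := fun v : List.Vector (Fin b) t => position J v.toList ω)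
  exact ⟨v.toList, mem_generation.2 v.toList_length, hv⟩

end Genealogy

/-! ### Independence over disjoint blocks of indices. -/

section Independence

variable {Ω ι κ : Type*}

/-- Blocks are split off one at a time; the induction also carries the measurability of the
intersection with respect to the blocks already used, which independence from the next block needs.
-/
lemma measure_inter_biInter_eq_mul_prod [MeasurableSpace Ω] {P : Measure Ω} {m : ι → MeasurableSpace Ω}
    (hle : ∀ i, m i ≤ ‹MeasurableSpace Ω›) (hm : iIndep m P) {T₀ : Set ι} {T : κ → Set ι}
    {S : Finset κ} (hT₀ : ∀ v ∈ S, Disjoint T₀ (T v))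
    (hT : ∀ v ∈ S, ∀ w ∈ S, v ≠ w → Disjoint (T v) (T w)) {A : Set Ω} {B : κ → Set Ω}
    (hA : MeasurableSet[⨆ i ∈ T₀, m i] A) (hB : ∀ v ∈ S, MeasurableSet[⨆ i ∈ T v, m i] (B v)) :
    P (A ∩ ⋂ v ∈ S, B v) = P A * ∏ v ∈ S, P (B v) := by
  classical
  suffices h : MeasurableSet[⨆ i ∈ T₀ ∪ ⋃ v ∈ S, T v, m i] (A ∩ ⋂ v ∈ S, B v) ∧
      P (A ∩ ⋂ v ∈ S, B v) = P A * ∏ v ∈ S, P (B v) from h.2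
  induction S using Finset.induction_on with
  | empty =>
    have hset : T₀ ∪ ⋃ v ∈ (∅ : Finset κ), T v = T₀ := by simp
    refine ⟨?_, by simp⟩
    rw [hset]
    simpa using hA
  | insert w S hw ih =>
    obtain ⟨h1, h2⟩ := ih (fun v hv => hT₀ v (Finset.mem_insert_of_mem hv))
      (fun v hv u hu => hT v (Finset.mem_insert_of_mem hv) u (Finset.mem_insert_of_mem hu))
      (fun v hv => hB v (Finset.mem_insert_of_mem hv))
    have hBw := hB w (Finset.mem_insert_self _ _)
    have hset : A ∩ ⋂ v ∈ insert w S, B v = (A ∩ ⋂ v ∈ S, B v) ∩ B w := by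
      rw [Finset.set_biInter_insert, Set.inter_comm (B w), Set.inter_assoc]
    have hdisj : Disjoint (T₀ ∪ ⋃ v ∈ S, T v) (T w) := by
      refine Set.disjoint_union_left.2 ⟨hT₀ w (Finset.mem_insert_self _ _), ?_⟩
      simp only [Set.disjoint_iUnion_left]
      exact fun v hv => hT v (Finset.mem_insert_of_mem hv) w (Finset.mem_insert_self _ _)
        (fun h => hw (h ▸ hv))
    rw [hset]
    refine ⟨?_, ?_⟩
    · refine MeasurableSet.inter ?_ ?_
      · refine (biSup_mono fun i hi => ?_ : (⨆ i ∈ T₀ ∪ ⋃ v ∈ S, T v, m i) ≤ _) _ h1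
        rcases hi with hi | hi
        · exact Or.inl hi
        · rw [Finset.set_biUnion_insert]
          exact Or.inr (Or.inr hi)
      · refine (biSup_mono fun i hi => ?_ : (⨆ i ∈ T w, m i) ≤ _) _ hBw
        rw [Finset.set_biUnion_insert]
        exact Or.inr (Or.inl hi)
    · rw [(Indep_iff _ _ P).1 (indep_iSup_of_disjoint hle hm hdisj) _ _ h1 hBw, h2,
        Finset.prod_insert hw, mul_assoc, mul_comm (P (B w))]

lemma measurable_biSup_comap {β : Type*} [MeasurableSpace β] {J : ι → Ω → β} {T : Set ι} {i : ι}
    (hi : i ∈ T) :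
    Measurable[⨆ i ∈ T, MeasurableSpace.comap (J i) inferInstance] (J i) :=
  (comap_measurable (J i)).mono
    (le_biSup (fun i => MeasurableSpace.comap (J i) inferInstance) hi) le_rfl

end Independence

/-! ### The many-to-one formula. -/

section ManyToOne

variable {b : ℕ} {Ω₀ : Type*} [MeasurableSpace Ω₀] {P₀ : Measure Ω₀}
  {η : Fin b → Fin b → Ω₀ → ℝ} {Ω : Type*} [MeasurableSpace Ω] {P : Measure Ω}
  {i₀ : Fin b} {J : List (Fin b) → Ω → Fin b → ℝ}

lemma IsWalk.isWalk_subtree (hJ : IsWalk η P₀ i₀ J P) (v : List (Fin b)) :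
    IsWalk η P₀ (colour i₀ v) (subtree J v) P where
  identDistrib w := by
    rw [← colour_append]
    exact hJ.identDistrib (w ++ v)
  indep := hJ.indep.precomp (g := fun w => w ++ v) fun _ _ h => List.append_cancel_right h

lemma IsWalk.map_jump (hJ : IsWalk η P₀ i₀ J P) (v : List (Fin b)) (j : Fin b) :
    P.map (fun ω => J v ω j) = stepLaw η P₀ (colour i₀ v) j :=
  ((hJ.identDistrib v).comp (measurable_pi_apply j)).map_eq

/-- The position of `v` involves only jumps from strictly shorter words. -/
lemma IsWalk.indepFun_position (hJ : IsWalk η P₀ i₀ J P) (hm : ∀ v, Measurable (J v))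
    (v : List (Fin b)) (j : Fin b) : IndepFun (position J v) (fun ω => J v ω j) P := by
  have h1 := indep_iSup_of_disjoint (fun u => (hm u).comap_le) hJ.indep.iIndep
    (S := {u | u.length < v.length}) (T := {v})
    (by simp)
  have h2 : Measurable[⨆ u ∈ {u : List (Fin b) | u.length < v.length},
      MeasurableSpace.comap (J u) inferInstance] (position J v) :=
    measurable_position v fun u hu => measurable_biSup_comap (J := J) hu
  have h3 : Measurable[⨆ u ∈ ({v} : Set (List (Fin b))),
      MeasurableSpace.comap (J u) inferInstance] (fun ω => J v ω j) :=
    (measurable_pi_apply j).comp (measurable_biSup_comap (J := J) (Set.mem_singleton v))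
  rw [IndepFun_iff_Indep]
  exact indep_of_indep_of_le_left (indep_of_indep_of_le_right h1 h3.comap_le) h2.comap_le

lemma IsWalk.lintegral_position_cons [IsProbabilityMeasure P] (hJ : IsWalk η P₀ i₀ J P)
    (hm : ∀ v, Measurable (J v)) (v : List (Fin b)) (j : Fin b) {f : ℝ → ℝ≥0∞}
    (hf : Measurable f) :
    ∫⁻ ω, f (position J (j :: v) ω) ∂P =
      ∫⁻ ω, ∫⁻ y, f (position J v ω + y) ∂stepLaw η P₀ (colour i₀ v) j ∂P := by
  have hp : Measurable (position J v) := measurable_position v fun u _ => hm u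
  have hj : Measurable fun ω => J v ω j := (measurable_pi_apply j).comp (hm v)
  have hf2 : Measurable fun q : ℝ × ℝ => f (q.1 + q.2) := hf.comp (by fun_prop)
  have hprod := (indepFun_iff_map_prod_eq_prod_map_map hp.aemeasurable hj.aemeasurable).1
    (hJ.indepFun_position hm v j)
  have := Measure.isProbabilityMeasure_map (μ := P) hj.aemeasurable
  have hinner : Measurable fun x => ∫⁻ y, f (x + y) ∂P.map (fun ω => J v ω j) :=
    Measurable.lintegral_prod_right' (f := fun q : ℝ × ℝ => f (q.1 + q.2)) hf2
  calc ∫⁻ ω, f (position J (j :: v) ω) ∂P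
      = ∫⁻ q, f (q.1 + q.2) ∂P.map (fun ω => (position J v ω, J v ω j)) :=
        (lintegral_map hf2 (hp.prodMk hj)).symm
    _ = ∫⁻ x, ∫⁻ y, f (x + y) ∂P.map (fun ω => J v ω j) ∂P.map (position J v) := by
        rw [hprod, lintegral_prod _ hf2.aemeasurable]
    _ = _ := by
        rw [lintegral_map hinner hp, hJ.map_jump]

/-- The many-to-one formula. -/
theorem IsWalk.sum_lintegral_position [IsProbabilityMeasure P] [IsProbabilityMeasure P₀]
    (hη : ∀ i j, AEMeasurable (η i j) P₀) (hJ : IsWalk η P₀ i₀ J P) (hm : ∀ v, Measurable (J v))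
    (k : ℕ) (j : Fin b) {f : ℝ → ℝ≥0∞} (hf : Measurable f) :
    ∑ v ∈ (generation b k).filter (fun v => colour i₀ v = j), ∫⁻ ω, f (position J v ω) ∂P =
      ∫⁻ z, f z ∂meanMeasure (stepLaw η P₀) k i₀ j := by
  have := isProbabilityMeasure_stepLaw hη
  induction k generalizing j f with
  | zero =>
    rw [Finset.sum_filter, generation, Finset.sum_singleton, meanMeasure]
    by_cases h : i₀ = j
    · simp [colour, h, position, lintegral_dirac' _ hf]
    · simp [colour, h]
  | succ k ih =>
    rw [lintegral_meanMeasure_succ k i₀ j hf, Finset.sum_filter, sum_generation_succ,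
      ← Finset.sum_fiberwise (generation b k) (colour i₀)]
    refine Finset.sum_congr rfl fun m _ => ?_
    have hf2 : Measurable fun q : ℝ × ℝ => f (q.1 + q.2) := hf.comp (by fun_prop)
    rw [← ih m (f := fun x => ∫⁻ y, f (x + y) ∂stepLaw η P₀ m j)
      (Measurable.lintegral_prod_right' (f := fun q : ℝ × ℝ => f (q.1 + q.2)) hf2)]
    refine Finset.sum_congr rfl fun v hv => ?_
    rw [Finset.mem_filter] at hv
    rw [Finset.sum_eq_single j (fun l _ hl => by simp [colour, hl]) (by simp)]
    rw [if_pos (by rfl), hJ.lintegral_position_cons hm v j hf, hv.2]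

lemma IsWalk.sum_measure_position_le [IsProbabilityMeasure P] [IsProbabilityMeasure P₀]
    (hη : ∀ i j, AEMeasurable (η i j) P₀) (hJ : IsWalk η P₀ i₀ J P) (hm : ∀ v, Measurable (J v))
    (k : ℕ) (j : Fin b) (c : ℝ) :
    ∑ v ∈ (generation b k).filter (fun v => colour i₀ v = j), P {ω | position J v ω ≤ c} =
      meanMeasure (stepLaw η P₀) k i₀ j (Set.Iic c) := by
  rw [← lintegral_indicator_one measurableSet_Iic, ← hJ.sum_lintegral_position hη hm k j
    (measurable_one.indicator measurableSet_Iic)]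
  refine Finset.sum_congr rfl fun v _ => ?_
  rw [← lintegral_indicator_one (measurableSet_le (measurable_position v fun u _ => hm u)
    measurable_const)]
  rfl

end ManyToOne

/-! ### The embedded branching process. -/

section Survival

variable {b : ℕ} {Ω : Type*}

/-- The event that the embedded branching process survives for `n` steps: a step goes from a
particle of type `i` to its descendants `k` generations later which are of type `i` again and
displaced by at most `c`. -/
def survival (k : ℕ) (c : ℝ) (i : Fin b) : ℕ → (List (Fin b) → Ω → Fin b → ℝ) → Set Ω
  | 0, _ => Set.univ
  | n + 1, J => ⋃ v ∈ (generation b k).filter (fun v => colour i v = i),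
      {ω | position J v ω ≤ c} ∩ survival k c i n (subtree J v)

variable {k : ℕ} {c : ℝ} {i : Fin b}

lemma measurableSet_survival {m : MeasurableSpace Ω} (n : ℕ)
    {J : List (Fin b) → Ω → Fin b → ℝ} (hJ : ∀ w, Measurable (J w)) :
    MeasurableSet (survival k c i n J) := by
  induction n generalizing J with
  | zero => exact MeasurableSet.univ
  | succ n ih =>
    exact Finset.measurableSet_biUnion _ fun v _ =>
      (measurableSet_le (measurable_position v fun u _ => hJ u) measurable_const).inter
        (ih fun w => hJ (w ++ v))

lemma survival_succ_subset (n : ℕ) (J : List (Fin b) → Ω → Fin b → ℝ) :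
    survival k c i (n + 1) J ⊆ survival k c i n J := by
  induction n generalizing J with
  | zero => exact Set.subset_univ _
  | succ n ih =>
    exact Set.iUnion₂_mono fun v _ => Set.inter_subset_inter_right _ (ih (subtree J v))

lemma exists_position_le_of_mem_survival {n : ℕ} {J : List (Fin b) → Ω → Fin b → ℝ} {ω : Ω}
    (h : ω ∈ survival k c i n J) :
    ∃ u : List (Fin b), u.length = n * k ∧ position J u ω ≤ n * c := by
  induction n generalizing J with
  | zero => exact ⟨[], by simp, by simp [position]⟩
  | succ n ih =>
    simp only [survival, Set.mem_iUnion] at h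
    obtain ⟨v, hv, hvc, hn⟩ := h
    obtain ⟨u, hu, huc⟩ := ih hn
    refine ⟨u ++ v, ?_, ?_⟩
    · rw [List.length_append, hu, mem_generation.1 (Finset.mem_filter.1 hv).1, add_mul, one_mul]
    · have : position J v ω ≤ c := hvc
      rw [position_append]
      push_cast
      linarith

end Survival

/-! ### Survival with positive probability, then almost surely. -/

section SurvivalProbability

variable {b : ℕ} {Ω₀ : Type*} [MeasurableSpace Ω₀] {P₀ : Measure Ω₀}
  {η : Fin b → Fin b → Ω₀ → ℝ} {Ω : Type*} {i : Fin b}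

/-- To be used with `n` the random number of offspring: the linear term integrates to the mean, and
the quadratic one is negligible for small `p`. -/
lemma one_sub_pow_le {p : ℝ} (hp0 : 0 ≤ p) (hp1 : p ≤ 1) (n : ℕ) :
    (1 - p) ^ n ≤ 1 - n * p + n ^ 2 * p ^ 2 := by
  induction n with
  | zero => simp
  | succ n ih =>
    have h1 : 0 ≤ 1 - p := by linarith
    have h2 : 0 ≤ (n : ℝ) * p ^ 2 := by positivity
    have h3 : 0 ≤ (n : ℝ) ^ 2 * p ^ 3 := by positivity
    calc (1 - p) ^ (n + 1) = (1 - p) ^ n * (1 - p) := pow_succ _ _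
      _ ≤ (1 - n * p + n ^ 2 * p ^ 2) * (1 - p) := by gcongr
      _ ≤ _ := by
        push_cast
        nlinarith [sq_nonneg p]

lemma disjoint_descendants {k : ℕ} {v w : List (Fin b)} (hv : v ∈ generation b k)
    (hw : w ∈ generation b k) (hvw : v ≠ w) :
    Disjoint (Set.range fun u : List (Fin b) => u ++ v) (Set.range fun u => u ++ w) := by
  rw [Set.disjoint_left]
  rintro _ ⟨u, rfl⟩ ⟨u', h⟩
  refine hvw (List.append_inj_right' h ?_).symm
  rw [mem_generation.1 hv, mem_generation.1 hw]

/-- Events in the subtrees of different particles of one generation are independent of each other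
and of the preceding generations. -/
lemma IsWalk.measure_inter_subtrees [MeasurableSpace Ω] {P : Measure Ω}
    {J : List (Fin b) → Ω → Fin b → ℝ} (hJ : IsWalk η P₀ i J P)
    (hm : ∀ v, Measurable (J v)) {k : ℕ} {S : Finset (List (Fin b))} (hS : S ⊆ generation b k)
    {A : Set Ω} (hA : MeasurableSet[⨆ u ∈ {u : List (Fin b) | u.length < k},
      MeasurableSpace.comap (J u) inferInstance] A) {B : List (Fin b) → Set Ω}
    (hB : ∀ v ∈ S, MeasurableSet[⨆ u ∈ Set.range fun u : List (Fin b) => u ++ v,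
      MeasurableSpace.comap (J u) inferInstance] (B v)) :
    P (A ∩ ⋂ v ∈ S, B v) = P A * ∏ v ∈ S, P (B v) := by
  refine measure_inter_biInter_eq_mul_prod (fun u => (hm u).comap_le) hJ.indep.iIndep
    (fun v hv => ?_) (fun v hv w hw hvw => disjoint_descendants (hS hv) (hS hw) hvw) hA hB
  rw [Set.disjoint_left]
  rintro _ hu ⟨u, rfl⟩
  have hu' : (u ++ v).length < k := hu
  rw [List.length_append, mem_generation.1 (hS hv)] at hu'
  omega

lemma measurableSet_survival_subtree {J : List (Fin b) → Ω → Fin b → ℝ} {k : ℕ} {c : ℝ} (n : ℕ)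
    (v : List (Fin b)) :
    MeasurableSet[⨆ u ∈ Set.range fun u : List (Fin b) => u ++ v,
      MeasurableSpace.comap (J u) inferInstance] (survival k c i n (subtree J v)) :=
  measurableSet_survival n fun w => measurable_biSup_comap (J := J) ⟨w, rfl⟩

/-- One step of the iteration of the survival probability of the embedded process. -/
lemma IsWalk.measure_compl_survival_succ_le [MeasurableSpace Ω] {P : Measure Ω}
    [IsProbabilityMeasure P] {k : ℕ} {c p e : ℝ} {n : ℕ} (hp0 : 0 ≤ p) (hp1 : p ≤ 1)
    (hpe : 1 - p * e + ((generation b k).card : ℝ) ^ 2 * p ^ 2 ≤ 1 - p)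
    (ih : ∀ J : List (Fin b) → Ω → Fin b → ℝ, IsWalk η P₀ i J P → (∀ v, Measurable (J v)) →
      P.real (survival k c i n J)ᶜ ≤ 1 - p)
    {J : List (Fin b) → Ω → Fin b → ℝ} (hJ : IsWalk η P₀ i J P) (hm : ∀ v, Measurable (J v))
    (he : e ≤ ∑ v ∈ (generation b k).filter (fun v => colour i v = i),
      P.real {ω | position J v ω ≤ c}) :
    P.real (survival k c i (n + 1) J)ᶜ ≤ 1 - p := by
  classical
  set V := (generation b k).filter (fun v => colour i v = i) with hV
  have hVsub : V ⊆ generation b k := Finset.filter_subset _ _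
  -- `G S` says that the offspring set is exactly `S`. These events partition the space and depend
  -- only on generations before `k`, so given `S` the extinctions of the subtrees are independent.
  set G : Finset (List (Fin b)) → Set Ω :=
    fun S => {ω | V.filter (fun v => position J v ω ≤ c) = S} with hG
  have hGeq : ∀ S ∈ V.powerset, G S =
      ⋂ v ∈ V, (if v ∈ S then {ω | position J v ω ≤ c} else {ω | position J v ω ≤ c}ᶜ) := by
    intro S hS
    ext ω
    simp only [hG, Set.mem_ofPred_eq, Set.mem_iInter, Finset.ext_iff, Finset.mem_filter]
    constructor
    · intro h v hv
      split_ifs with hvS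
      · exact ((h v).2 hvS).2
      · exact fun hc => hvS ((h v).1 ⟨hv, hc⟩)
    · intro h v
      constructor
      · rintro ⟨hv, hc⟩
        by_contra hvS
        have := h v hv
        rw [if_neg hvS] at this
        exact this hc
      · intro hvS
        have hv := Finset.mem_powerset.1 hS hvS
        have := h v hv
        rw [if_pos hvS] at this
        exact ⟨hv, this⟩
  have hGmeas' : ∀ S ∈ V.powerset, MeasurableSet[⨆ u ∈ {u : List (Fin b) | u.length < k},
      MeasurableSpace.comap (J u) inferInstance] (G S) := by
    intro S hS
    rw [hGeq S hS]
    refine Finset.measurableSet_biInter _ fun v hv => ?_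
    have hpos : MeasurableSet[⨆ u ∈ {u : List (Fin b) | u.length < k},
        MeasurableSpace.comap (J u) inferInstance] {ω | position J v ω ≤ c} :=
      measurableSet_le (measurable_position v fun u hu => measurable_biSup_comap (J := J) (by
        rw [mem_generation.1 (hVsub hv)] at hu
        exact hu)) measurable_const
    split_ifs
    · exact hpos
    · exact hpos.compl
  have hGmeas : ∀ S ∈ V.powerset, MeasurableSet (G S) := fun S hS =>
    (iSup₂_le fun u _ => (hm u).comap_le : _ ≤ ‹MeasurableSpace Ω›) _ (hGmeas' S hS)
  have hcover : (survival k c i (n + 1) J)ᶜ ⊆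
      ⋃ S ∈ V.powerset, (G S ∩ ⋂ v ∈ S, (survival k c i n (subtree J v))ᶜ) := by
    intro ω hω
    simp only [survival, Set.mem_compl_iff, Set.mem_iUnion, not_exists, Set.mem_inter_iff,
      not_and] at hω
    simp only [Set.mem_iUnion]
    refine ⟨V.filter (fun v => position J v ω ≤ c), Finset.mem_powerset.2 (Finset.filter_subset _ _),
      rfl, Set.mem_iInter₂.2 fun v hv => ?_⟩
    obtain ⟨hv, hc⟩ := Finset.mem_filter.1 hv
    exact hω v hv hc
  have hterm : ∀ S ∈ V.powerset, P.real (G S ∩ ⋂ v ∈ S, (survival k c i n (subtree J v))ᶜ) ≤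
      P.real (G S) * (1 - p) ^ S.card := by
    intro S hS
    have hSV := Finset.mem_powerset.1 hS
    rw [measureReal_def, hJ.measure_inter_subtrees hm (hSV.trans hVsub) (hGmeas' S hS)
      (fun v _ => (measurableSet_survival_subtree n v).compl), ENNReal.toReal_mul,
      ENNReal.toReal_prod]
    refine mul_le_mul_of_nonneg_left ?_ ENNReal.toReal_nonneg
    rw [← Finset.prod_const]
    refine Finset.prod_le_prod (fun _ _ => ENNReal.toReal_nonneg) fun v hv => ?_
    refine ih (subtree J v) ?_ (fun w => hm (w ++ v))
    have := hJ.isWalk_subtree v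
    rwa [(Finset.mem_filter.1 (hSV hv)).2] at this
  have hposmeas : ∀ v, MeasurableSet {ω | position J v ω ≤ c} := fun v =>
    measurableSet_le (measurable_position v fun u _ => hm u) measurable_const
  have hindint : ∀ {A : Set Ω}, MeasurableSet A → ∀ a : ℝ,
      Integrable (A.indicator fun _ => a) P := fun hA a => (integrable_const a).indicator hA
  set N : ℝ := ((generation b k).card : ℝ) with hN
  calc P.real (survival k c i (n + 1) J)ᶜ
      ≤ ∑ S ∈ V.powerset, P.real (G S ∩ ⋂ v ∈ S, (survival k c i n (subtree J v))ᶜ) :=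
        (measureReal_mono hcover (measure_ne_top _ _)).trans (measureReal_biUnion_finset_le _ _)
    _ ≤ ∑ S ∈ V.powerset, P.real (G S) * (1 - p) ^ S.card := Finset.sum_le_sum hterm
    _ = ∫ ω, ∑ S ∈ V.powerset, (G S).indicator (fun _ => (1 - p) ^ S.card) ω ∂P := by
        rw [integral_finsetSum _ fun S hS => hindint (hGmeas S hS) _]
        refine Finset.sum_congr rfl fun S hS => ?_
        rw [integral_indicator_const _ (hGmeas S hS), smul_eq_mul]
    -- The integrand on the left is `(1 - p) ^ Z` with `Z ≤ N` the number of offspring.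
    _ ≤ ∫ ω, (1 + N ^ 2 * p ^ 2 -
          ∑ v ∈ V, {ω | position J v ω ≤ c}.indicator (fun _ => p) ω) ∂P := by
        refine integral_mono (integrable_finsetSum _ fun S hS => hindint (hGmeas S hS) _)
          ((integrable_const _).sub (integrable_finsetSum _ fun v _ => hindint (hposmeas v) _))
          fun ω => ?_
        have hmem : V.filter (fun v => position J v ω ≤ c) ∈ V.powerset :=
          Finset.mem_powerset.2 (Finset.filter_subset _ _)
        simp only
        have hsingle : ∑ S ∈ V.powerset, (G S).indicator (fun _ => (1 - p) ^ S.card) ω =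
            (1 - p) ^ (V.filter (fun v => position J v ω ≤ c)).card := by
          rw [Finset.sum_eq_single_of_mem _ hmem]
          · exact Set.indicator_of_mem (show ω ∈ G _ from rfl) _
          · exact fun S _ hne => Set.indicator_of_notMem
              (show ω ∉ G S from fun h => hne (Eq.symm h)) _
        rw [hsingle]
        refine (one_sub_pow_le hp0 hp1 _).trans ?_
        have hcard : ((V.filter (fun v => position J v ω ≤ c)).card : ℝ) ≤ N :=
          Nat.cast_le.2 (Finset.card_le_card ((Finset.filter_subset _ _).trans hVsub))
        have hsum : ∑ v ∈ V, {ω | position J v ω ≤ c}.indicator (fun _ => p) ω =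
            (V.filter (fun v => position J v ω ≤ c)).card * p := by
          rw [← nsmul_eq_mul, ← Finset.sum_const]
          refine Eq.trans (Finset.sum_congr rfl fun v _ => ?_) (Finset.sum_filter _ _).symm
          rw [Set.indicator_apply]
          rfl
        rw [hsum]
        have : ((V.filter (fun v => position J v ω ≤ c)).card : ℝ) ^ 2 * p ^ 2 ≤ N ^ 2 * p ^ 2 := by
          gcongr
        linarith
    _ = 1 + N ^ 2 * p ^ 2 - p * ∑ v ∈ V, P.real {ω | position J v ω ≤ c} := by
        rw [integral_sub (integrable_const _)
          (integrable_finsetSum _ fun v _ => hindint (hposmeas v) _),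
          integral_finsetSum _ fun v _ => hindint (hposmeas v) _, Finset.mul_sum]
        simp only [integral_const, probReal_univ, one_smul]
        congr 1
        refine Finset.sum_congr rfl fun v _ => ?_
        rw [integral_indicator_const _ (hposmeas v), smul_eq_mul, mul_comm]
    _ ≤ 1 + N ^ 2 * p ^ 2 - p * e := by gcongr
    _ ≤ 1 - p := by linarith

/-- If the mean offspring of the embedded process exceeds `1`, then it survives with a
probability that is bounded below. -/
theorem exists_survival_probability [IsProbabilityMeasure P₀] [MeasurableSpace Ω] {P : Measure Ω}
    [IsProbabilityMeasure P]
    (hη : ∀ i j, AEMeasurable (η i j) P₀) {k : ℕ} {c : ℝ}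
    (hmean : 1 < meanMeasure (stepLaw η P₀) k i i (Set.Iic c)) :
    ∃ p : ℝ, 0 < p ∧ p ≤ 1 ∧ ∀ J : List (Fin b) → Ω → Fin b → ℝ, IsWalk η P₀ i J P →
      (∀ v, Measurable (J v)) → ∀ n, P.real (survival k c i n J)ᶜ ≤ 1 - p := by
  have := isProbabilityMeasure_stepLaw hη
  set e := (meanMeasure (stepLaw η P₀) k i i).real (Set.Iic c) with he
  have he1 : 1 < e := by
    rw [he, measureReal_def, ← ENNReal.toReal_one]
    exact (ENNReal.toReal_lt_toReal ENNReal.one_ne_top (measure_ne_top _ _)).2 hmean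
  set N : ℝ := ((generation b k).card : ℝ) with hN
  have hN0 : 0 < N ^ 2 + 1 := by positivity
  -- So small that `N ^ 2 * p ^ 2 ≤ p * (e - 1)`: the bound `1 - p` on the extinction probability
  -- then reproduces itself from one step to the next.
  obtain ⟨p, hp⟩ : ∃ p, p = min 1 ((e - 1) / (N ^ 2 + 1)) := ⟨_, rfl⟩
  have hp0 : 0 < p := by
    rw [hp]
    exact lt_min one_pos (div_pos (by linarith) hN0)
  have hp1 : p ≤ 1 := hp ▸ min_le_left _ _
  have hp2 : p * (N ^ 2 + 1) ≤ e - 1 := (le_div_iff₀ hN0).1 (hp ▸ min_le_right _ _)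
  refine ⟨p, hp0, hp1, fun J hJ hm n => ?_⟩
  induction n generalizing J with
  | zero => simpa [survival] using hp1
  | succ n ih =>
    refine hJ.measure_compl_survival_succ_le (e := e) hp0.le hp1 ?_ ih hm (le_of_eq ?_)
    · nlinarith
    · rw [he, measureReal_def, ← hJ.sum_measure_position_le hη hm,
        ENNReal.toReal_sum fun v _ => measure_ne_top _ _]
      rfl

/-- Almost surely there are surviving particles in some generation of every residue class. -/
theorem IsWalk.ae_exists_survival [IsProbabilityMeasure P₀] [MeasurableSpace Ω] {P : Measure Ω}
    [IsProbabilityMeasure P] (hb : 2 ≤ b)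
    (hη : ∀ i j, AEMeasurable (η i j) P₀) {k : ℕ} (hk : 1 ≤ k) {c : ℝ}
    (hmean : 1 < meanMeasure (stepLaw η P₀) k i i (Set.Iic c))
    {J : List (Fin b) → Ω → Fin b → ℝ} (hJ : IsWalk η P₀ i J P) (hm : ∀ v, Measurable (J v))
    (r : ℕ) :
    ∀ᵐ ω ∂P, ∃ v : List (Fin b), v.length % k = r % k ∧
      ∀ n, ω ∈ survival k c i n (subtree J v) := by
  obtain ⟨p, hp0, hp1, hp⟩ := exists_survival_probability (P := P) hη hmean
  have hq0 : 0 ≤ 1 - p := by linarith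
  set U : List (Fin b) → Set Ω :=
    fun v => (⋂ n, survival k c i n (subtree J v))ᶜ with hU
  have hUmeas : ∀ v, MeasurableSet[⨆ u ∈ Set.range fun u : List (Fin b) => u ++ v,
      MeasurableSpace.comap (J u) inferInstance] (U v) := fun v =>
    (MeasurableSet.iInter fun n => measurableSet_survival_subtree n v).compl
  have hUle : ∀ u, P (U (i :: u)) ≤ ENNReal.ofReal (1 - p) := by
    intro u
    have hsub : IsWalk η P₀ i (subtree J (i :: u)) P := hJ.isWalk_subtree (i :: u)
    have hsubm : ∀ w, Measurable (subtree J (i :: u) w) := fun w => hm _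
    have hmono : Monotone fun n => (survival k c i n (subtree J (i :: u)))ᶜ :=
      monotone_nat_of_le_succ fun n => Set.compl_subset_compl.2 (survival_succ_subset n _)
    have hlim := tendsto_measure_iUnion_atTop (μ := P) hmono
    rw [hU]
    simp only [Set.compl_iInter]
    refine le_of_tendsto' hlim fun n => ?_
    rw [Function.comp_apply, ← ofReal_measureReal]
    exact ENNReal.ofReal_le_ofReal (hp _ hsub hsubm n)
  set Bad : Set Ω := {ω | ¬ ∃ v : List (Fin b), v.length % k = r % k ∧
      ∀ n, ω ∈ survival k c i n (subtree J v)} with hBad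
  have hle : ∀ N : ℕ, P Bad ≤ ENNReal.ofReal (1 - p) ^ N := by
    intro N
    -- The trials are the particles of type `i` in generation `m + k`, which is congruent to `r`.
    -- Adding `k ≥ 1` makes that generation nonzero, so its words have the form `i :: u`, and there
    -- are `b ^ M ≥ N` of them.
    set m := r + k * N with hmdef
    have hNm : N ≤ m := by nlinarith
    obtain ⟨M, hM⟩ : ∃ M, M + 1 = m + k := ⟨m + k - 1, by omega⟩
    set S : Finset (List (Fin b)) := (generation b M).image (fun u => i :: u) with hS
    have hSsub : S ⊆ generation b (M + 1) := by
      intro v hv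
      obtain ⟨u, hu, rfl⟩ := Finset.mem_image.1 hv
      rw [mem_generation, List.length_cons, mem_generation.1 hu]
    have hcard : N ≤ S.card := by
      rw [hS, Finset.card_image_of_injective _ (List.cons_injective), card_generation]
      calc N ≤ M := by omega
        _ ≤ b ^ M := (Nat.lt_pow_self (by omega)).le
    have hsub : Bad ⊆ Set.univ ∩ ⋂ v ∈ S, U v := by
      intro ω hω
      refine ⟨Set.mem_univ _, Set.mem_iInter₂.2 fun v hv hv' => hω ⟨v, ?_, Set.mem_iInter.1 hv'⟩⟩
      rw [mem_generation.1 (hSsub hv), hM, hmdef]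
      simp
    calc P Bad ≤ P (Set.univ ∩ ⋂ v ∈ S, U v) := measure_mono hsub
      _ = P Set.univ * ∏ v ∈ S, P (U v) :=
          hJ.measure_inter_subtrees hm hSsub MeasurableSet.univ fun v _ => hUmeas v
      _ ≤ ∏ _v ∈ S, ENNReal.ofReal (1 - p) := by
          rw [measure_univ, one_mul]
          refine Finset.prod_le_prod' fun v hv => ?_
          obtain ⟨u, -, rfl⟩ := Finset.mem_image.1 hv
          exact hUle u
      _ = ENNReal.ofReal (1 - p) ^ S.card := Finset.prod_const _
      _ ≤ ENNReal.ofReal (1 - p) ^ N :=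
          pow_le_pow_right_of_le_one' (by
            rw [← ENNReal.ofReal_one]
            exact ENNReal.ofReal_le_ofReal (by linarith)) hcard
  have hlim : Tendsto (fun N : ℕ => ENNReal.ofReal (1 - p) ^ N) atTop (𝓝 0) :=
    ENNReal.tendsto_pow_atTop_nhds_zero_of_lt_one (by
      rw [ENNReal.ofReal_lt_one]
      linarith)
  exact le_antisymm (ge_of_tendsto' hlim hle) zero_le

end SurvivalProbability

/-! ### The two almost sure bounds and the speed. -/

section Limit

variable {b : ℕ} {Ω₀ : Type*} [MeasurableSpace Ω₀] {P₀ : Measure Ω₀} [IsProbabilityMeasure P₀]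
  {η : Fin b → Fin b → Ω₀ → ℝ} {Ω : Type*} [MeasurableSpace Ω] {P : Measure Ω}
  [IsProbabilityMeasure P] {i₀ : Fin b} {J : List (Fin b) → Ω → Fin b → ℝ}

/-- Chernoff's bound for the mean measures. -/
lemma meanMeasure_Iic_le (hη : ∀ i j, AEMeasurable (η i j) P₀) {s : ℝ} (hs : 0 ≤ s)
    (hD : s ∈ expDomain η P₀) (k : ℕ) (i j : Fin b) (c : ℝ) :
    meanMeasure (stepLaw η P₀) k i j (Set.Iic c) ≤
      ENNReal.ofReal (Real.exp (s * c) * (momentMatrix η P₀ s ^ k) i j) := by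
  have hmeas : Measurable fun z : ℝ => ENNReal.ofReal (Real.exp (-(s * z))) := by fun_prop
  rw [ENNReal.ofReal_mul (Real.exp_pos _).le, ← lintegral_exp_meanMeasure_stepLaw hη hD,
    ← lintegral_const_mul _ hmeas, ← lintegral_indicator_one measurableSet_Iic]
  refine lintegral_mono fun z => ?_
  rw [← ENNReal.ofReal_mul (Real.exp_pos _).le, ← Real.exp_add]
  by_cases hz : z ∈ Set.Iic c
  · rw [Set.indicator_of_mem hz, Pi.one_apply, ENNReal.one_le_ofReal, Real.one_le_exp_iff]
    have : s * z ≤ s * c := mul_le_mul_of_nonneg_left hz hs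
    linarith
  · rw [Set.indicator_of_notMem hz]
    exact zero_le

/-- To the left of the crossing point, `μ_t` is eventually larger than `t * x`. -/
theorem IsWalk.ae_eventually_lt_minDisplacement (hb : 0 < b)
    (hη : ∀ i j, AEMeasurable (η i j) P₀) (hJ : IsWalk η P₀ i₀ J P) (hm : ∀ v, Measurable (J v))
    {x : ℝ} (hx : lam η P₀ x < 1) :
    ∀ᵐ ω ∂P, ∀ᶠ t : ℕ in atTop, t * x < minDisplacement J t ω := by
  obtain ⟨s, hs, hlt⟩ : ∃ s : ℝ, 0 ≤ s ∧ ENNReal.ofReal (Real.exp (s * x)) * rho η P₀ s < 1 := by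
    simpa only [lam, iInf_lt_iff, exists_prop] using hx
  have hD : s ∈ expDomain η P₀ := by
    by_contra hD
    rw [rho, if_neg hD, ENNReal.mul_top (by simp [Real.exp_pos])] at hlt
    exact not_top_lt hlt
  obtain ⟨hr, ⟨C, hC, hup⟩, -⟩ := pow_apply_bounds hb (momentMatrix_pos hD)
  set r := largestEigenvalue (momentMatrix η P₀ s) with hrdef
  set q := Real.exp (s * x) * r with hq
  have hq0 : 0 ≤ q := by positivity
  have hq1 : q < 1 := by
    rwa [rho_of_mem hD, ← ENNReal.ofReal_mul (Real.exp_pos _).le, ENNReal.ofReal_lt_one] at hlt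
  have hbound : ∀ t : ℕ, P {ω | minDisplacement J t ω ≤ t * x} ≤
      ENNReal.ofReal (b * C * q ^ t) := by
    intro t
    have hsub : {ω | minDisplacement J t ω ≤ t * x} ⊆
        ⋃ v ∈ generation b t, {ω | position J v ω ≤ t * x} := by
      intro ω hω
      obtain ⟨v, hv, hvω⟩ := exists_position_eq_minDisplacement hb J t ω
      exact Set.mem_biUnion (Finset.mem_coe.2 hv) (hvω.le.trans hω)
    calc P {ω | minDisplacement J t ω ≤ t * x}
        ≤ ∑ v ∈ generation b t, P {ω | position J v ω ≤ t * x} :=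
          (measure_mono hsub).trans (measure_biUnion_finset_le _ _)
      _ = ∑ j, meanMeasure (stepLaw η P₀) t i₀ j (Set.Iic (t * x)) := by
          rw [← Finset.sum_fiberwise (generation b t) (colour i₀)]
          exact Finset.sum_congr rfl fun j _ => hJ.sum_measure_position_le hη hm t j _
      _ ≤ ∑ _j : Fin b, ENNReal.ofReal (C * q ^ t) := by
          refine Finset.sum_le_sum fun j _ => (meanMeasure_Iic_le hη hs hD t i₀ j _).trans
            (ENNReal.ofReal_le_ofReal ?_)
          calc Real.exp (s * (t * x)) * (momentMatrix η P₀ s ^ t) i₀ j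
              ≤ Real.exp (s * (t * x)) * (C * r ^ t) := by gcongr; exact hup t i₀ j
            _ = C * q ^ t := by
                rw [hq, mul_pow, ← Real.exp_nat_mul, mul_left_comm s]
                ring
      _ = ENNReal.ofReal (b * C * q ^ t) := by
          rw [Finset.sum_const, Finset.card_univ, Fintype.card_fin, nsmul_eq_mul, mul_assoc,
            ENNReal.ofReal_mul (Nat.cast_nonneg b), ENNReal.ofReal_natCast]
  have hsum : ∑' t : ℕ, P {ω | minDisplacement J t ω ≤ t * x} ≠ ⊤ :=
    ne_top_of_le_ne_top
      ((summable_geometric_of_lt_one hq0 hq1).mul_left _).tsum_ofReal_ne_top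
      (ENNReal.tsum_le_tsum hbound)
  filter_upwards [ae_eventually_notMem hsum] with ω hω
  filter_upwards [hω] with t ht
  exact not_le.1 ht

/-- To the right of the crossing point, `μ_t` is at most `t * x` up to a constant. -/
theorem IsWalk.ae_minDisplacement_le (hb : 2 ≤ b)
    (hη : ∀ i j, AEMeasurable (η i j) P₀) (hJ : IsWalk η P₀ i₀ J P) (hm : ∀ v, Measurable (J v))
    {x' x : ℝ} (hxx : x' < x) (hx : 1 < lam η P₀ x') :
    ∀ᵐ ω ∂P, ∃ D : ℝ, ∀ᶠ t : ℕ in atTop, minDisplacement J t ω ≤ t * x + D := by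
  obtain ⟨k, hk, hmean⟩ := exists_one_lt_meanMeasure hb hη hxx hx i₀
  filter_upwards [ae_all_iff.2 fun r => hJ.ae_exists_survival hb hη hk hmean hm r] with ω hω
  choose v hv hsurv using hω
  -- For `t` congruent to `r` modulo `k`, generation `t` is reached from `v r` by whole steps of `k`
  -- generations, each costing at most `k * x`. Only the offset of `v r` remains, and the sum covers
  -- all residues at once.
  refine ⟨∑ r ∈ Finset.range k, |position J (v r) ω - (v r).length * x|, ?_⟩
  filter_upwards [eventually_ge_atTop (∑ r ∈ Finset.range k, (v r).length)] with t ht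
  set r := t % k with hr
  have hrk : r ∈ Finset.range k := Finset.mem_range.2 (Nat.mod_lt _ hk)
  have hlen : (v r).length ≤ t :=
    (Finset.single_le_sum (f := fun r => (v r).length) (fun _ _ => zero_le) hrk).trans ht
  obtain ⟨n, hn⟩ : k ∣ t - (v r).length := by
    refine (Nat.modEq_iff_dvd' hlen).1 ?_
    rw [Nat.ModEq, hv, hr, Nat.mod_mod]
  have htn : t = n * k + (v r).length := by rw [mul_comm, ← hn]; omega
  obtain ⟨u, hu, hpos⟩ := exists_position_le_of_mem_survival (hsurv r n)
  have h1 : minDisplacement J t ω ≤ position J (u ++ v r) ω :=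
    minDisplacement_le_position J (by rw [List.length_append, hu, htn]) ω
  rw [position_append] at h1
  have h2 : |position J (v r) ω - (v r).length * x| ≤
      ∑ r ∈ Finset.range k, |position J (v r) ω - (v r).length * x| :=
    Finset.single_le_sum (f := fun r => |position J (v r) ω - (v r).length * x|)
      (fun _ _ => abs_nonneg _) hrk
  have h3 := le_abs_self (position J (v r) ω - (v r).length * x)
  have h4 : (t : ℝ) * x = n * (k * x) + (v r).length * x := by
    rw [htn]
    push_cast
    ring
  linarith

/-- Rational slopes suffice, so that only countably many almost sure statements have to be combined.
-/
lemma tendsto_div_of_bounds {μ : ℕ → ℝ} {x₀ : ℝ}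
    (hlow : ∀ x : ℚ, (x : ℝ) < x₀ → ∀ᶠ t : ℕ in atTop, t * (x : ℝ) < μ t)
    (hup : ∀ x : ℚ, x₀ < x → ∃ D : ℝ, ∀ᶠ t : ℕ in atTop, μ t ≤ t * (x : ℝ) + D) :
    Tendsto (fun t : ℕ => μ t / (t : ℝ)) atTop (𝓝 x₀) := by
  rw [tendsto_order]
  constructor
  · intro a ha
    obtain ⟨x, hx1, hx2⟩ := exists_rat_btwn ha
    filter_upwards [hlow x hx2, eventually_gt_atTop 0] with t ht ht0
    have ht0' : (0 : ℝ) < t := by exact_mod_cast ht0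
    rw [lt_div_iff₀ ht0']
    nlinarith
  · intro a ha
    obtain ⟨x, hx1, hx2⟩ := exists_rat_btwn ha
    obtain ⟨D, hD⟩ := hup x hx1
    have hgt : ∀ᶠ t : ℕ in atTop, D / (a - x) < t :=
      tendsto_natCast_atTop_atTop.eventually_gt_atTop _
    filter_upwards [hD, eventually_gt_atTop 0, hgt] with t ht ht0 htD
    have ht0' : (0 : ℝ) < t := by exact_mod_cast ht0
    rw [div_lt_iff₀ (by linarith)] at htD
    rw [div_lt_iff₀ ht0']
    nlinarith

theorem IsWalk.ae_tendsto_of_measurable (hb : 2 ≤ b)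
    (hη : ∀ i j, AEMeasurable (η i j) P₀) (hJ : IsWalk η P₀ i₀ J P) (hm : ∀ v, Measurable (J v))
    {x₀ : ℝ} (hlt : ∀ x, x < x₀ → lam η P₀ x < 1) (hgt : ∀ x, x₀ < x → 1 < lam η P₀ x) :
    ∀ᵐ ω ∂P, Tendsto (fun t : ℕ => minDisplacement J t ω / (t : ℝ)) atTop (𝓝 x₀) := by
  have hlow : ∀ᵐ ω ∂P, ∀ x : ℚ, (x : ℝ) < x₀ →
      ∀ᶠ t : ℕ in atTop, t * (x : ℝ) < minDisplacement J t ω := by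
    refine ae_all_iff.2 fun x => ?_
    by_cases hx : (x : ℝ) < x₀
    · filter_upwards [hJ.ae_eventually_lt_minDisplacement (by omega) hη hm (hlt x hx)] with ω h _
      exact h
    · exact Eventually.of_forall fun ω h => absurd h hx
  have hup : ∀ᵐ ω ∂P, ∀ x : ℚ, x₀ < x →
      ∃ D : ℝ, ∀ᶠ t : ℕ in atTop, minDisplacement J t ω ≤ t * (x : ℝ) + D := by
    refine ae_all_iff.2 fun x => ?_
    by_cases hx : x₀ < (x : ℝ)
    · obtain ⟨y, hy1, hy2⟩ := exists_between hx
      filter_upwards [hJ.ae_minDisplacement_le hb hη hm hy2 (hgt y hy1)] with ω h _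
      exact h
    · exact Eventually.of_forall fun ω h => absurd h hx
  filter_upwards [hlow, hup] with ω h1 h2
  exact tendsto_div_of_bounds h1 h2

/-- The minimal displacement has speed `x₀`, the point where `lam` crosses the level `1`. -/
theorem IsWalk.ae_tendsto (hb : 2 ≤ b)
    (hη : ∀ i j, AEMeasurable (η i j) P₀) (hJ : IsWalk η P₀ i₀ J P)
    {x₀ : ℝ} (hlt : ∀ x, x < x₀ → lam η P₀ x < 1) (hgt : ∀ x, x₀ < x → 1 < lam η P₀ x) :
    ∀ᵐ ω ∂P, Tendsto (fun t : ℕ => minDisplacement J t ω / (t : ℝ)) atTop (𝓝 x₀) := by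
  have hae : ∀ v, AEMeasurable (J v) P := fun v => (hJ.identDistrib v).aemeasurable_fst
  -- Identity in distribution gives only almost everywhere measurable jumps. There are countably
  -- many words, so measurable versions agree with them at all words simultaneously, almost surely.
  set J' : List (Fin b) → Ω → Fin b → ℝ := fun v => (hae v).mk (J v) with hJ'
  have hwalk : IsWalk η P₀ i₀ J' P :=
    { identDistrib := fun v =>
        (IdentDistrib.of_ae_eq (hae v) (hae v).ae_eq_mk).symm.trans (hJ.identDistrib v)
      indep := hJ.indep.congr fun v => (hae v).ae_eq_mk }
  filter_upwards [hwalk.ae_tendsto_of_measurable hb hη (fun v => (hae v).measurable_mk) hlt hgt,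
    ae_all_iff.2 fun v => (hae v).ae_eq_mk] with ω h heq
  have : ∀ t, minDisplacement J t ω = minDisplacement J' t ω := fun t =>
    iInf_congr fun v => position_congr heq _
  simpa only [this] using h

end Limit

end ColouredBRW

theorem proposition5 {b : ℕ} (hb : 2 ≤ b)
    {Ω₀ : Type*} [MeasurableSpace Ω₀] (P₀ : Measure Ω₀) [IsProbabilityMeasure P₀]
    (η : Fin b → Fin b → Ω₀ → ℝ) (hη : ColouredBRW.Regular η P₀)
    {Ω : Type*} [MeasurableSpace Ω] (P : Measure Ω) [IsProbabilityMeasure P]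
    (i₀ : Fin b) (J : List (Fin b) → Ω → Fin b → ℝ) (hJ : ColouredBRW.IsWalk η P₀ i₀ J P) :
    -- whenever the equation has a solution, it is unique and is the limit
    (∀ x₀ : ℝ, ColouredBRW.lam η P₀ x₀ = 1 →
      (∀ x : ℝ, ColouredBRW.lam η P₀ x = 1 → x = x₀) ∧
      ∀ᵐ ω ∂P, Tendsto (fun t : ℕ => ColouredBRW.minDisplacement J t ω / (t : ℝ))
        atTop (𝓝 x₀)) ∧
    -- the equation has a solution unless the function jumps over the interval (0, 1]
    ((∃ x : ℝ, 0 < ColouredBRW.lam η P₀ x ∧ ColouredBRW.lam η P₀ x ≤ 1) →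
      ∃ x₀ : ℝ, ColouredBRW.lam η P₀ x₀ = 1) ∧
    -- in all cases the limit is the point where the function crosses the level 1
    (∃ x₀ : ℝ, (∀ x : ℝ, x < x₀ → ColouredBRW.lam η P₀ x < 1) ∧
      (∀ x : ℝ, x₀ < x → 1 < ColouredBRW.lam η P₀ x) ∧
      ∀ᵐ ω ∂P, Tendsto (fun t : ℕ => ColouredBRW.minDisplacement J t ω / (t : ℝ))
        atTop (𝓝 x₀)) := by
  obtain ⟨x₀, hlt, hgt⟩ := ColouredBRW.exists_lam_crossing hb hη
  have hlim := hJ.ae_tendsto hb (fun i j => (hη.integrable_log i j).aemeasurable) hlt hgt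
  have huniq : ∀ x, ColouredBRW.lam η P₀ x = 1 → x = x₀ := by
    intro x hx
    rcases lt_trichotomy x x₀ with h | h | h
    · exact absurd hx (hlt x h).ne
    · exact h
    · exact absurd hx (hgt x h).ne'
  refine ⟨fun y hy => ?_, ?_, x₀, hlt, hgt, hlim⟩
  · obtain rfl := huniq y hy
    exact ⟨huniq, hlim⟩
  · rintro ⟨x, hx0, hx1⟩
    exact ⟨x₀, ColouredBRW.lam_crossing_eq_one hlt hgt hx0 hx1⟩
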